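/- Let $(X,\mathcal B)$ be a measurable space with countably generated $\sigma$-algebra, let $m=(m_x)_{x\in X}$ be a random walk on it (probability measures on $\mathcal B$ such that $x\mapsto m_x(B)$ is measurable for each $B\in\mathcal B$), and let $\nu$ be a $\sigma$-finite measure that is reversible for $m$, i.e. $dm_x(y)\,d\nu(x)=dm_y(x)\,d\nu(y)$. For $\Omega\in\mathcal B$ put $\partial_m\Omega=\{x\in X\setminus\Omega: m_x(\Omega)>0\}$ and $\Omega_m=\Omega\cup\partial_m\Omega$. Assume that $0<\nu(\Omega)<\nu(\Omega_m)<\infty$ and that $\Omega$ is $m$-connected: $\int_A m_x(B)\,d\nu(x)>0$ whenever $A,B\in\mathcal B$ are non-$\nu$-null with $A\cup B=\Omega$. Write $\nabla f(x,y)=f(y)-f(x)$ and let $P_m(E)=\frac12\int_{X\times X}|\nabla \mathbf 1_E(x,y)|\,dm_x(y)\,d\nu(x)$ be the $m$-perimeter of $E$. Put $$h_1^m(\Omega)=\inf\Big\{\tfrac{P_m(E)}{\nu(E)}: E\in\mathcal B,\ E\subset\Omega,\ \nu(E)>0\Big\},\qquad h_p^m(\Omega)=\inf\Big\{\tfrac{P_m(E)}{\nu(E)^p}: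 E\in\mathcal B,\ E\subset\Omega,\ \nu(E)>0\Big\}\quad(p>1).$$ Let $L^p_0(\Omega_m,\nu)$ be the set of $f\in L^p(\Omega_m,\nu)$ with $f=0$ a.e. on $\partial_m\Omega$. We say that $\Omega$ satisfies a $p$-Poincaré inequality if there is $\lambda>0$ with $\lambda\int_\Omega|f|^p\,d\nu\le\int_{\Omega_m\times\Omega_m}|\nabla f(x,y)|^p\,dm_x(y)\,d\nu(x)$ for all $f\in L^p_0(\Omega_m,\nu)$. For $p>1$, a $p$-torsional function of $\Omega$ is an $f\in L_0^p(\Omega_m,\nu)$ with $$-\int_{\Omega_m}|f(y)-f(x)|^{p-2}(f(y)-f(x))\,dm_x(y)=1\quad\text{for }\nu\text{-a.e. }x\in\Omega.$$ (i) Let $p>1$ and let $\Omega$ satisfy a $p$-Poincaré inequality. Then $\Omega$ has a $p$-torsional function $f_{\Omega,p}$, unique up to $\nu$-a.e. equality on $\Omega_m$; the $p$-torsional rigidity $T_{m,p}(\Omega)=\big(\int_\Omega f_{\Omega,p}\,d\nu\big)^{p-1}$ is positive; and $$2^{p-1}\frac{h_1^m(\Omega)^p}{\nu(\Omega_m)^{p-1}}\le\frac1{T_{m,p}(\Omega)}\le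 h_p^m(\Omega).$$ (ii) If $\Omega$ satisfies a $p$-Poincaré inequality for all $p>1$ sufficiently close to $1$, then $$\lim_{p\to1^+}\frac1{T_{m,p}(\Omega)}=\lim_{p\to1^+}h_p^m(\Omega)=h_1^m(\Omega).$$ -/

import Mathlib

open MeasureTheory ProbabilityTheory Set Filter
open scoped Topology

noncomputable section

/-! A random walk on `X` is a Markov kernel `m : Kernel X X`; `ν` is a measure on `X`.
Functions on the closure `Ω_m` are represented by functions on `X`, of which only the values
on `Ω_m` are used. -/

namespace RandomWalk

variable {X : Type*} [MeasurableSpace X]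

/-- The nonlocal gradient `∇f (x, y) = f y - f x`. -/
def grad (f : X → ℝ) (z : X × X) : ℝ := f z.2 - f z.1

/-- The `m`-interaction `L_m(A, B) = ∫_A m_x(B) dν(x)`. -/
def interaction (m : Kernel X X) (ν : Measure X) (A B : Set X) : ENNReal :=
  ∫⁻ x in A, m x B ∂ν

/-- `Ω` is `m`-connected with respect to `ν`: any two non-null measurable sets whose union is `Ω`
have positive interaction. -/
def IsConnectedSet (m : Kernel X X) (ν : Measure X) (Ω : Set X) : Prop :=
  ∀ A B : Set X, MeasurableSet A → MeasurableSet B → A ∪ B = Ω → ν A ≠ 0 → ν B ≠ 0 →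
    0 < interaction m ν A B

/-- The `m`-boundary `∂_m Ω`. -/
def bdry (m : Kernel X X) (Ω : Set X) : Set X := {x | x ∉ Ω ∧ 0 < m x Ω}

/-- The `m`-closure `Ω_m = Ω ∪ ∂_m Ω`. -/
def cl (m : Kernel X X) (Ω : Set X) : Set X := Ω ∪ bdry m Ω

/-- The `m`-total variation `TV_m(f) = (1/2) ∫_{X × X} |∇f| d(ν ⊗ m_x)`, possibly `∞`. -/
def totalVariation (m : Kernel X X) (ν : Measure X) (f : X → ℝ) : ENNReal :=
  (1 / 2) * ∫⁻ z, ENNReal.ofReal |grad f z| ∂(ν ⊗ₘ m)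

/-- The `m`-perimeter `P_m(E) = TV_m(1_E)`. -/
def perimeter (m : Kernel X X) (ν : Measure X) (E : Set X) : ENNReal :=
  totalVariation m ν (E.indicator fun _ => 1)

/-- The `m`-Cheeger constant `h_1^m(Ω)`. -/
def cheeger (m : Kernel X X) (ν : Measure X) (Ω : Set X) : ℝ :=
  sInf {r : ℝ | ∃ E : Set X, MeasurableSet E ∧ E ⊆ Ω ∧ 0 < ν E ∧
    r = (perimeter m ν E).toReal / (ν E).toReal}

/-- The `m`-`p`-Cheeger constant `h_p^m(Ω)`. -/
def pCheeger (m : Kernel X X) (ν : Measure X) (Ω : Set X) (p : ℝ) : ℝ :=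
  sInf {r : ℝ | ∃ E : Set X, MeasurableSet E ∧ E ⊆ Ω ∧ 0 < ν E ∧
    r = (perimeter m ν E).toReal / (ν E).toReal ^ p}

/-- `f ∈ L^p_0(Ω_m, ν)`: `f` is in `L^p(Ω_m, ν)` and vanishes a.e. on `∂_m Ω`. -/
def MemLpZero (m : Kernel X X) (ν : Measure X) (Ω : Set X) (p : ℝ) (f : X → ℝ) : Prop :=
  MemLp f (ENNReal.ofReal p) (ν.restrict (cl m Ω)) ∧ ∀ᵐ x ∂(ν.restrict (bdry m Ω)), f x = 0

/-- `Ω` satisfies a `p`-Poincaré inequality. -/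
def Poincare (m : Kernel X X) (ν : Measure X) (Ω : Set X) (p : ℝ) : Prop :=
  ∃ lam : ℝ, 0 < lam ∧ ∀ f : X → ℝ, MemLpZero m ν Ω p f →
    lam * ∫ x in Ω, |f x| ^ p ∂ν ≤ ∫ z in cl m Ω ×ˢ cl m Ω, |grad f z| ^ p ∂(ν ⊗ₘ m)

/-- The nonlocal `p`-Laplacian
`Δ_{m,p} f (x) = ∫_{Ω_m} |f y - f x|^{p-2} (f y - f x) dm_x(y)`. -/
def pLaplacian (m : Kernel X X) (Ω : Set X) (p : ℝ) (f : X → ℝ) (x : X) : ℝ :=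
  ∫ y in cl m Ω, |grad f (x, y)| ^ (p - 2) * grad f (x, y) ∂(m x)

/-- `f` is a `p`-torsional function of `Ω`: it lies in `L^p_0(Ω_m, ν)`, so it vanishes
on `∂_m Ω`, and `-Δ_{m,p} f = 1` in `Ω` (`ν`-a.e.). -/
def IsTorsional (m : Kernel X X) (ν : Measure X) (Ω : Set X) (p : ℝ) (f : X → ℝ) : Prop :=
  MemLpZero m ν Ω p f ∧ ∀ᵐ x ∂(ν.restrict Ω), -pLaplacian m Ω p f x = 1

open Classical in
/-- The `m`-`p`-torsional rigidity `T_{m,p}(Ω) = (∫_Ω f dν)^{p-1}`, where `f` is the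
`p`-torsional function of `Ω` (with the value `0` if there is none). -/
def torsionalRigidity (m : Kernel X X) (ν : Measure X) (Ω : Set X) (p : ℝ) : ℝ :=
  if h : ∃ f : X → ℝ, IsTorsional m ν Ω p f then (∫ x in Ω, h.choose x ∂ν) ^ (p - 1) else 0

end RandomWalk

end

namespace RandomWalk

section ClosureMeasure

variable {X : Type*} [MeasurableSpace X] {m : Kernel X X} {ν : Measure X} {Ω : Set X}

lemma measurableSet_bdry (m : Kernel X X) (hΩ : MeasurableSet Ω) : MeasurableSet (bdry m Ω) :=
  hΩ.compl.inter (measurableSet_lt measurable_const (Kernel.measurable_coe m hΩ))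

lemma measurableSet_cl (m : Kernel X X) (hΩ : MeasurableSet Ω) : MeasurableSet (cl m Ω) :=
  hΩ.union (measurableSet_bdry m hΩ)

lemma subset_cl (m : Kernel X X) (Ω : Set X) : Ω ⊆ cl m Ω := subset_union_left

/-- The measure `ν ⊗ m_x` restricted to `Ω_m × Ω_m`. -/
noncomputable def pairMeasure (m : Kernel X X) (ν : Measure X) (Ω : Set X) : Measure (X × X) :=
  (ν ⊗ₘ m).restrict (cl m Ω ×ˢ cl m Ω)

variable [IsMarkovKernel m] [SigmaFinite ν]

lemma pairMeasure_prod (hΩ : MeasurableSet Ω) {s t : Set X} (hs : MeasurableSet s)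
    (ht : MeasurableSet t) :
    pairMeasure m ν Ω (s ×ˢ t) = ∫⁻ x in s ∩ cl m Ω, m x (t ∩ cl m Ω) ∂ν := by
  have hc := measurableSet_cl m hΩ
  rw [pairMeasure, Measure.restrict_apply (hs.prod ht), prod_inter_prod,
    Measure.compProd_apply_prod (hs.inter hc) (ht.inter hc)]

lemma map_fst_pairMeasure_le (hΩ : MeasurableSet Ω) :
    (pairMeasure m ν Ω).map Prod.fst ≤ ν.restrict (cl m Ω) := by
  refine Measure.le_iff.2 fun s hs => ?_
  rw [Measure.map_apply measurable_fst hs, ← prod_univ, pairMeasure_prod hΩ hs .univ,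
    Measure.restrict_apply hs]
  calc _ ≤ ∫⁻ _ in s ∩ cl m Ω, 1 ∂ν := lintegral_mono fun x => prob_le_one
    _ = _ := by simp

lemma pairMeasure_univ_le (hΩ : MeasurableSet Ω) :
    pairMeasure m ν Ω univ ≤ ν (cl m Ω) := by
  have h := map_fst_pairMeasure_le (m := m) (ν := ν) hΩ univ
  rwa [Measure.map_apply measurable_fst .univ, preimage_univ, Measure.restrict_apply_univ] at h

lemma isFiniteMeasure_pairMeasure (hΩ : MeasurableSet Ω) (hfin : ν (cl m Ω) < ⊤) :
    IsFiniteMeasure (pairMeasure m ν Ω) :=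
  ⟨(pairMeasure_univ_le hΩ).trans_lt hfin⟩

lemma map_swap_pairMeasure (hrev : m.IsReversible ν) (hΩ : MeasurableSet Ω)
    (hfin : ν (cl m Ω) < ⊤) :
    (pairMeasure m ν Ω).map Prod.swap = pairMeasure m ν Ω := by
  have := isFiniteMeasure_pairMeasure hΩ hfin
  have hc := measurableSet_cl m hΩ
  refine Measure.ext_prod fun {s t} hs ht => ?_
  rw [Measure.map_apply measurable_swap (hs.prod ht), preimage_swap_prod,
    pairMeasure_prod hΩ ht hs, pairMeasure_prod hΩ hs ht]
  exact hrev (ht.inter hc) (hs.inter hc)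

lemma map_snd_pairMeasure_le (hrev : m.IsReversible ν) (hΩ : MeasurableSet Ω)
    (hfin : ν (cl m Ω) < ⊤) :
    (pairMeasure m ν Ω).map Prod.snd ≤ ν.restrict (cl m Ω) := by
  have h : (Prod.snd : X × X → X) = Prod.fst ∘ Prod.swap := rfl
  rw [h, ← Measure.map_map measurable_fst measurable_swap, map_swap_pairMeasure hrev hΩ hfin]
  exact map_fst_pairMeasure_le hΩ

lemma compProd_compl_cl_eq_zero (hrev : m.IsReversible ν) (hΩ : MeasurableSet Ω) :
    (ν ⊗ₘ m) (Ω ×ˢ (cl m Ω)ᶜ) = 0 ∧ (ν ⊗ₘ m) ((cl m Ω)ᶜ ×ˢ Ω) = 0 := by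
  have hc := (measurableSet_cl m hΩ).compl
  have h : ∫⁻ x in (cl m Ω)ᶜ, m x Ω ∂ν = 0 := by
    rw [setLIntegral_eq_zero_iff hc (Kernel.measurable_coe m hΩ)]
    refine ae_of_all _ fun x hx => ?_
    by_contra hne
    exact hx (by_cases (fun h : x ∈ Ω => Or.inl h) fun h => Or.inr ⟨h, pos_iff_ne_zero.2 hne⟩)
  rw [Measure.compProd_apply_prod hΩ hc, Measure.compProd_apply_prod hc hΩ, hrev hΩ hc]
  exact ⟨h, h⟩

lemma perimeter_eq (hrev : m.IsReversible ν) (hΩ : MeasurableSet Ω) {E : Set X} (hE : E ⊆ Ω) :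
    perimeter m ν E = (1 / 2) * ∫⁻ z, ENNReal.ofReal |grad (E.indicator fun _ => 1) z|
      ∂(pairMeasure m ν Ω) := by
  have hc := measurableSet_cl m hΩ
  rw [perimeter, totalVariation, pairMeasure, ← lintegral_indicator (hc.prod hc)]
  congr 1
  obtain ⟨h1, h2⟩ := compProd_compl_cl_eq_zero hrev hΩ
  refine lintegral_congr_ae ?_
  filter_upwards [measure_eq_zero_iff_ae_notMem.1 h1, measure_eq_zero_iff_ae_notMem.1 h2]
    with z hz1 hz2
  by_cases hz : z ∈ cl m Ω ×ˢ cl m Ω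
  · rw [indicator_of_mem hz]
  rw [indicator_of_notMem hz]
  have hs := subset_cl m Ω
  have ha : z.1 ∉ E := fun h => hz1 ⟨hE h, fun h' => hz ⟨hs (hE h), h'⟩⟩
  have hb : z.2 ∉ E := fun h => hz2 ⟨fun h' => hz ⟨h', hs (hE h)⟩, hE h⟩
  simp [grad, ha, hb]

end ClosureMeasure

section RealPower

variable {p : ℝ}

/-- The odd power function `a ↦ |a|^{p-2} a`, the derivative of `a ↦ |a|^p / p`. -/
noncomputable def oddPow (p a : ℝ) : ℝ := |a| ^ (p - 2) * a

lemma oddPow_neg (p a : ℝ) : oddPow p (-a) = -oddPow p a := by simp [oddPow]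

lemma abs_oddPow (hp : 1 < p) (a : ℝ) : |oddPow p a| = |a| ^ (p - 1) := by
  rcases eq_or_ne a 0 with rfl | ha
  · simp [oddPow, Real.zero_rpow (sub_ne_zero.2 hp.ne')]
  · have h : 0 < |a| := abs_pos.2 ha
    rw [oddPow, abs_mul, abs_of_nonneg (by positivity), ← Real.rpow_add_one h.ne']
    congr 1; ring

lemma oddPow_mul_self (hp : 1 < p) (a : ℝ) : oddPow p a * a = |a| ^ p := by
  rcases eq_or_ne a 0 with rfl | ha
  · simp [oddPow, Real.zero_rpow (by linarith : p ≠ 0)]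
  · have h : 0 < |a| := abs_pos.2 ha
    rw [oddPow, mul_assoc, ← abs_mul_abs_self a, ← mul_assoc, ← Real.rpow_add_one h.ne',
      ← Real.rpow_add_one h.ne']
    congr 1; ring

lemma continuous_oddPow (hp : 1 < p) : Continuous (oddPow p) := by
  refine continuous_iff_continuousAt.2 fun a => ?_
  rcases eq_or_ne a 0 with rfl | ha
  · have h0 : oddPow p 0 = 0 := by simp [oddPow]
    rw [ContinuousAt, h0, tendsto_zero_iff_abs_tendsto_zero]
    have h1 : Continuous fun a : ℝ => |a| ^ (p - 1) :=
      continuous_abs.rpow_const fun _ => Or.inr (by linarith)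
    have h2 := h1.tendsto 0
    simp only [abs_zero, Real.zero_rpow (sub_ne_zero.2 hp.ne')] at h2
    exact h2.congr fun a => (abs_oddPow hp a).symm
  · exact (continuous_abs.continuousAt.rpow_const (Or.inl (abs_ne_zero.2 ha))).mul continuousAt_id

lemma continuous_abs_rpow (hp : 1 < p) : Continuous fun a : ℝ => |a| ^ p :=
  continuous_abs.rpow_const fun _ => Or.inr (by linarith)

/-- Young's inequality for `|a|^{p-1} |b|`. -/
lemma mul_abs_oddPow_mul_le (hp : 1 < p) (a b : ℝ) :
    p * |oddPow p a * b| ≤ (p - 1) * |a| ^ p + |b| ^ p := by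
  have hp0 : p ≠ 0 := by linarith
  have h1 : p - 1 ≠ 0 := by linarith
  have hc : (p / (p - 1)).HolderConjugate p := (Real.HolderConjugate.conjExponent hp).symm
  have h := Real.young_inequality_of_nonneg (abs_nonneg (oddPow p a)) (abs_nonneg b) hc
  rw [abs_oddPow hp, ← Real.rpow_mul (abs_nonneg a), mul_div_cancel₀ _ h1] at h
  rw [abs_mul, abs_oddPow hp]
  calc _ ≤ p * (|a| ^ p / (p / (p - 1)) + |b| ^ p / p) := by gcongr
    _ = _ := by field_simp

lemma abs_oddPow_mul_le (hp : 1 < p) (a b : ℝ) : |oddPow p a * b| ≤ |a| ^ p + |b| ^ p := by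
  have h := mul_abs_oddPow_mul_le hp a b
  have ha : 0 ≤ |a| ^ p := by positivity
  have hb : 0 ≤ |b| ^ p := by positivity
  refine le_of_mul_le_mul_left (h.trans ?_) (zero_lt_one.trans hp)
  nlinarith

lemma abs_rpow_add_le (hp : 1 < p) (a b : ℝ) :
    |a| ^ p + p * (oddPow p a * (b - a)) ≤ |b| ^ p := by
  have h := mul_abs_oddPow_mul_le hp a b
  have h1 := mul_le_mul_of_nonneg_left (le_abs_self (oddPow p a * b)) (zero_le_one.trans hp.le)
  have h2 := oddPow_mul_self hp a
  rw [mul_sub, h2, mul_sub]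
  linarith

/-- The convexity defect of `a ↦ |a|^p` at the midpoint of `a` and `b`. -/
noncomputable def defect (p a b : ℝ) : ℝ := (|a| ^ p + |b| ^ p) / 2 - |(a + b) / 2| ^ p

lemma defect_pos (hp : 1 < p) {a b : ℝ} (hab : a ≠ b) : 0 < defect p a b := by
  rw [defect, sub_pos]
  have hp0 : 0 < p := by linarith
  rcases eq_or_ne |a| |b| with h | h
  · rcases abs_eq_abs.1 h with h | rfl
    · exact absurd h hab
    · have hb : b ≠ 0 := by rintro rfl; simp at hab
      have := Real.rpow_pos_of_pos (abs_pos.2 hb) p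
      simp only [neg_add_cancel, zero_div, abs_zero, Real.zero_rpow hp0.ne', abs_neg]
      linarith
  · have h1 := (strictConvexOn_rpow hp).2 (abs_nonneg a) (abs_nonneg b) h
      (half_pos one_pos) (half_pos one_pos) (by norm_num)
    simp only [smul_eq_mul] at h1
    have h2 : |(a + b) / 2| ≤ 1 / 2 * |a| + 1 / 2 * |b| := by
      rw [abs_div, abs_two]; linarith [abs_add_le a b]
    have h3 := Real.rpow_le_rpow (abs_nonneg _) h2 hp0.le
    linarith

lemma defect_nonneg (hp : 1 < p) (a b : ℝ) : 0 ≤ defect p a b := by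
  rcases eq_or_ne a b with rfl | h
  · simp [defect]
  · exact (defect_pos hp h).le

lemma continuous_defect (hp : 1 < p) : Continuous fun z : ℝ × ℝ => defect p z.1 z.2 := by
  have h := continuous_abs_rpow hp
  exact (((h.comp continuous_fst).add (h.comp continuous_snd)).div_const 2).sub
    (h.comp ((continuous_fst.add continuous_snd).div_const 2))

lemma defect_mul {s : ℝ} (hs : 0 ≤ s) (a b : ℝ) :
    defect p (s * a) (s * b) = s ^ p * defect p a b := by
  have h : (s * a + s * b) / 2 = s * ((a + b) / 2) := by ring
  simp only [defect, h, abs_mul, abs_of_nonneg hs, Real.mul_rpow hs (abs_nonneg _)]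
  ring

/-- Uniform convexity of `a ↦ |a|^p`. -/
lemma exists_abs_sub_rpow_le (hp : 1 < p) {ε : ℝ} (hε : 0 < ε) :
    ∃ C : ℝ, 0 ≤ C ∧ ∀ a b : ℝ, |a - b| ^ p ≤ C * defect p a b + ε * (|a| ^ p + |b| ^ p) := by
  have hp0 : 0 < p := by linarith
  have hc := continuous_abs_rpow hp
  have hcs : Continuous fun z : ℝ × ℝ => |z.1 - z.2| ^ p :=
    hc.comp (continuous_fst.sub continuous_snd)
  set K : Set (ℝ × ℝ) := {z | |z.1| ^ p + |z.2| ^ p = 1 ∧ ε ≤ |z.1 - z.2| ^ p} with hK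
  have hclosed : IsClosed K :=
    (isClosed_eq ((hc.comp continuous_fst).add (hc.comp continuous_snd)) continuous_const).inter
      (isClosed_le continuous_const hcs)
  have hle : ∀ t : ℝ, |t| ^ p ≤ 1 → t ∈ Icc (-1 : ℝ) 1 := fun t ht => by
    rw [mem_Icc, ← abs_le]
    by_contra! h
    exact ht.not_gt (Real.one_lt_rpow h hp0)
  have hcomp : IsCompact K := by
    refine (isCompact_Icc.prod isCompact_Icc : IsCompact (Icc (-1 : ℝ) 1 ×ˢ Icc (-1 : ℝ) 1))
      |>.of_isClosed_subset hclosed fun z hz => ⟨hle _ ?_, hle _ ?_⟩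
    · linarith [hz.1, Real.rpow_nonneg (abs_nonneg z.2) p]
    · linarith [hz.1, Real.rpow_nonneg (abs_nonneg z.1) p]
  have hdpos : ∀ z ∈ K, 0 < defect p z.1 z.2 := fun z hz => defect_pos hp fun h => by
    have := hz.2
    rw [h, sub_self, abs_zero, Real.zero_rpow hp0.ne'] at this
    linarith
  obtain ⟨C, hC⟩ := hcomp.exists_bound_of_continuousOn
    (f := fun z => |z.1 - z.2| ^ p / defect p z.1 z.2)
    (hcs.continuousOn.div (continuous_defect hp).continuousOn fun z hz => (hdpos z hz).ne')
  have hunit : ∀ a b : ℝ, |a| ^ p + |b| ^ p = 1 →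
      |a - b| ^ p ≤ max C 0 * defect p a b + ε := fun a b h => by
    have hd := defect_nonneg hp a b
    by_cases hz : ε ≤ |a - b| ^ p
    · have h1 := (le_abs_self _).trans (hC (a, b) ⟨h, hz⟩)
      rw [div_le_iff₀ (hdpos (a, b) ⟨h, hz⟩)] at h1
      have h2 : C * defect p a b ≤ max C 0 * defect p a b := by gcongr; exact le_max_left _ _
      simp only at h1
      linarith
    · have : 0 ≤ max C 0 * defect p a b := by positivity
      linarith
  refine ⟨max C 0, le_max_right _ _, fun a b => ?_⟩
  set r := |a| ^ p + |b| ^ p with hr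
  have ha0 : 0 ≤ |a| ^ p := by positivity
  have hb0 : 0 ≤ |b| ^ p := by positivity
  rcases (add_nonneg ha0 hb0).eq_or_lt with h0 | h0
  · have ha : |a| ^ p = 0 := by linarith
    have hb : |b| ^ p = 0 := by linarith
    rw [Real.rpow_eq_zero (abs_nonneg _) hp0.ne', abs_eq_zero] at ha hb
    have hd := defect_nonneg hp a b
    rw [hr, ha, hb]
    simp [defect, Real.zero_rpow hp0.ne']
  · set s := r ^ (1 / p) with hs
    have hs0 : 0 < s := Real.rpow_pos_of_pos h0 _
    have hsp : s ^ p = r := by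
      rw [hs, ← Real.rpow_mul h0.le, one_div_mul_cancel hp0.ne', Real.rpow_one]
    have hae : a = s * (a / s) := by field_simp
    have hbe : b = s * (b / s) := by field_simp
    have h1 : |a / s| ^ p + |b / s| ^ p = 1 := by
      rw [abs_div, abs_div, abs_of_pos hs0, Real.div_rpow (abs_nonneg _) hs0.le,
        Real.div_rpow (abs_nonneg _) hs0.le, hsp, ← add_div, ← hr, div_self h0.ne']
    have h2 := mul_le_mul_of_nonneg_left (hunit _ _ h1) h0.le
    have h3 : |a - b| ^ p = r * |a / s - b / s| ^ p := by
      rw [← sub_div, abs_div, abs_of_pos hs0, Real.div_rpow (abs_nonneg _) hs0.le, hsp,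
        mul_div_cancel₀ _ h0.ne']
    have h4 : defect p a b = r * defect p (a / s) (b / s) := by
      conv_lhs => rw [hae, hbe]
      rw [defect_mul hs0.le, hsp]
    rw [h3, h4]
    linarith

lemma exists_le_mul_rpow_add (hp : 1 < p) {η : ℝ} (hη : 0 < η) :
    ∃ C : ℝ, ∀ t : ℝ, 0 ≤ t → t ≤ η * t ^ p + C := by
  have hp1 : 0 < p - 1 := by linarith
  refine ⟨(1 / η) ^ (1 / (p - 1)), fun t ht => ?_⟩
  have hC : 0 ≤ (1 / η) ^ (1 / (p - 1)) := by positivity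
  rcases le_total t ((1 / η) ^ (1 / (p - 1))) with h | h
  · have : 0 ≤ η * t ^ p := by positivity
    linarith
  · have h0 : 0 < t := (Real.rpow_pos_of_pos (by positivity) _).trans_le h
    have h1 := Real.rpow_le_rpow hC h hp1.le
    rw [← Real.rpow_mul (by positivity), one_div_mul_cancel hp1.ne', Real.rpow_one,
      div_le_iff₀ hη] at h1
    have h2 : t ^ p = t ^ (p - 1) * t := by
      rw [← Real.rpow_add_one h0.ne']; congr 1; ring
    rw [h2]
    nlinarith

lemma eq_of_oddPow_sub_mul_sub_nonpos (hp : 1 < p) {a b : ℝ}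
    (h : (oddPow p a - oddPow p b) * (a - b) ≤ 0) : a = b := by
  by_contra hab
  have h1 := abs_rpow_add_le hp a ((a + b) / 2)
  have h2 := abs_rpow_add_le hp b a
  have h3 := defect_pos hp hab
  rw [defect] at h3
  have h4 : oddPow p a * ((a + b) / 2 - a) = -(oddPow p a * (a - b)) / 2 := by ring
  rw [h4] at h1
  have h5 : p * ((oddPow p a - oddPow p b) * (a - b)) ≤ 0 :=
    mul_nonpos_of_nonneg_of_nonpos (by linarith) h
  nlinarith

lemma oddPow_sub_mul_sub_nonneg (hp : 1 < p) (a b : ℝ) :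
    0 ≤ (oddPow p a - oddPow p b) * (a - b) := by
  by_contra! h
  have := eq_of_oddPow_sub_mul_sub_nonpos hp h.le
  simp [this] at h

end RealPower

section Energy

variable {p : ℝ}

lemma integrable_abs_rpow {Y : Type*} [MeasurableSpace Y] {Q : Measure Y} (hp : 1 < p)
    {F : Y → ℝ} (hF : MemLp F (ENNReal.ofReal p) Q) : Integrable (fun z => |F z| ^ p) Q := by
  have h := hF.integrable_norm_rpow (by simpa using zero_lt_one.trans hp) ENNReal.ofReal_ne_top
  rwa [ENNReal.toReal_ofReal (by linarith)] at h

lemma integrable_oddPow_mul {Y : Type*} [MeasurableSpace Y] {Q : Measure Y} (hp : 1 < p)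
    {F G : Y → ℝ} (hF : MemLp F (ENNReal.ofReal p) Q) (hG : MemLp G (ENNReal.ofReal p) Q) :
    Integrable (fun z => oddPow p (F z) * G z) Q := by
  refine ((integrable_abs_rpow hp hF).add (integrable_abs_rpow hp hG)).mono'
    (((continuous_oddPow hp).comp_aestronglyMeasurable hF.1).mul hG.1)
    (ae_of_all _ fun z => abs_oddPow_mul_le hp _ _)

/-- Hölder's inequality for `|F|^{p-1} |G|`. -/
lemma integral_oddPow_mul_le {Y : Type*} [MeasurableSpace Y] {Q : Measure Y} (hp : 1 < p)
    {F G : Y → ℝ} (hF : MemLp F (ENNReal.ofReal p) Q) (hG : MemLp G (ENNReal.ofReal p) Q) :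
    ∫ z, oddPow p (F z) * G z ∂Q ≤
      (∫ z, |F z| ^ p ∂Q) ^ ((p - 1) / p) * (∫ z, |G z| ^ p ∂Q) ^ (1 / p) := by
  have hp0 : 0 < p := by linarith
  have hp1 : 0 < p - 1 := by linarith
  have hc : (p / (p - 1)).HolderConjugate p := (Real.HolderConjugate.conjExponent hp).symm
  have hpow : ∀ z, ‖oddPow p (F z)‖ ^ (p / (p - 1)) = |F z| ^ p := fun z => by
    rw [Real.norm_eq_abs, abs_oddPow hp, ← Real.rpow_mul (abs_nonneg _),
      mul_div_cancel₀ _ hp1.ne']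
  have hmem : MemLp (fun z => oddPow p (F z)) (ENNReal.ofReal (p / (p - 1))) Q := by
    have h0 : 0 < p / (p - 1) := by positivity
    rw [← integrable_norm_rpow_iff ((continuous_oddPow hp).comp_aestronglyMeasurable hF.1)
      (by simpa using h0) ENNReal.ofReal_ne_top, ENNReal.toReal_ofReal h0.le]
    simpa only [Function.comp_apply, hpow] using integrable_abs_rpow hp hF
  have h := integral_mul_norm_le_Lp_mul_Lq hc hmem hG
  simp only [hpow, one_div_div] at h
  refine (integral_mono (integrable_oddPow_mul hp hF hG) ?_ fun z => ?_).trans h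
  · simpa only [norm_mul] using (integrable_oddPow_mul hp hF hG).norm
  · exact (le_abs_self _).trans (abs_mul _ _).le

variable {X : Type*} [MeasurableSpace X] {μ : Measure X} {Q : Measure (X × X)}

lemma memLp_comp_fst (hfst : Q.map Prod.fst ≤ μ) {f : X → ℝ} {r : ENNReal} (hf : MemLp f r μ) :
    MemLp (fun z : X × X => f z.1) r Q ∧ eLpNorm (fun z : X × X => f z.1) r Q ≤ eLpNorm f r μ := by
  have h := hf.mono_measure hfst
  refine ⟨(memLp_map_measure_iff h.1 measurable_fst.aemeasurable).1 h, ?_⟩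
  rw [show (fun z : X × X => f z.1) = f ∘ Prod.fst from rfl,
    ← eLpNorm_map_measure h.1 measurable_fst.aemeasurable]
  exact eLpNorm_mono_measure f hfst

lemma memLp_comp_snd (hsnd : Q.map Prod.snd ≤ μ) {f : X → ℝ} {r : ENNReal} (hf : MemLp f r μ) :
    MemLp (fun z : X × X => f z.2) r Q ∧ eLpNorm (fun z : X × X => f z.2) r Q ≤ eLpNorm f r μ := by
  have h := hf.mono_measure hsnd
  refine ⟨(memLp_map_measure_iff h.1 measurable_snd.aemeasurable).1 h, ?_⟩
  rw [show (fun z : X × X => f z.2) = f ∘ Prod.snd from rfl,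
    ← eLpNorm_map_measure h.1 measurable_snd.aemeasurable]
  exact eLpNorm_mono_measure f hsnd

lemma memLp_grad (hfst : Q.map Prod.fst ≤ μ) (hsnd : Q.map Prod.snd ≤ μ) {f : X → ℝ}
    {r : ENNReal} (hf : MemLp f r μ) : MemLp (grad f) r Q :=
  (memLp_comp_snd hsnd hf).1.sub (memLp_comp_fst hfst hf).1

lemma eLpNorm_grad_le (hfst : Q.map Prod.fst ≤ μ) (hsnd : Q.map Prod.snd ≤ μ) {f : X → ℝ}
    {r : ENNReal} (hr : 1 ≤ r) (hf : MemLp f r μ) :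
    eLpNorm (grad f) r Q ≤ 2 * eLpNorm f r μ := by
  have h1 := memLp_comp_fst hfst hf
  have h2 := memLp_comp_snd hsnd hf
  refine (eLpNorm_sub_le h2.1.1 h1.1.1 hr).trans ?_
  rw [two_mul]
  exact add_le_add h2.2 h1.2

lemma grad_ae_eq (hfst : Q.map Prod.fst ≤ μ) (hsnd : Q.map Prod.snd ≤ μ) {f g : X → ℝ}
    (h : f =ᵐ[μ] g) : grad f =ᵐ[Q] grad g := by
  have h1 := ae_of_ae_map measurable_fst.aemeasurable (ae_mono hfst h)
  have h2 := ae_of_ae_map measurable_snd.aemeasurable (ae_mono hsnd h)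
  filter_upwards [h1, h2] with z hz1 hz2
  simp only [grad, hz1, hz2]

/-- Nonlocal integration by parts. -/
lemma integral_oddPow_grad_mul_grad (hp : 1 < p) (hfst : Q.map Prod.fst ≤ μ)
    (hswap : Q.map Prod.swap = Q) {f h : X → ℝ} (hf : MemLp (grad f) (ENNReal.ofReal p) Q)
    (hh : MemLp h (ENNReal.ofReal p) μ) :
    ∫ z, oddPow p (grad f z) * grad h z ∂Q = -2 * ∫ z, oddPow p (grad f z) * h z.1 ∂Q := by
  have hsw : MeasurePreserving Prod.swap Q Q := ⟨measurable_swap, hswap⟩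
  have hodd : ∀ z : X × X, oddPow p (grad f z.swap) = -oddPow p (grad f z) := fun z => by
    rw [← oddPow_neg]; simp [grad]
  have h1 := integrable_oddPow_mul hp hf (memLp_comp_fst hfst hh).1
  have h2 : Integrable (fun z => -(oddPow p (grad f z) * h z.2)) Q := by
    refine (hsw.integrable_comp_emb MeasurableEquiv.prodComm.measurableEmbedding).2 h1 |>.congr
      (ae_of_all _ fun z => ?_)
    simp [hodd]
  have h3 : ∫ z, -(oddPow p (grad f z) * h z.2) ∂Q = ∫ z, oddPow p (grad f z) * h z.1 ∂Q := by
    rw [← hsw.integral_comp MeasurableEquiv.prodComm.measurableEmbedding]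
    exact integral_congr_ae (ae_of_all _ fun z => by simp [hodd])
  have h4 : ∀ z, oddPow p (grad f z) * grad h z
      = -(-(oddPow p (grad f z) * h z.2) + oddPow p (grad f z) * h z.1) := fun z => by
    simp only [grad]; ring
  simp_rw [h4]
  rw [integral_neg, integral_add h2 h1, h3]
  ring

end Energy

section WeakFormulation

variable {X : Type*} [MeasurableSpace X] {m : Kernel X X} {ν : Measure X} {Ω : Set X} {p : ℝ}

/-- A function in `L^p_0(Ω_m, ν)` agrees a.e. on `Ω_m` with its restriction to `Ω`. -/
lemma MemLpZero.ae_eq_indicator (hΩ : MeasurableSet Ω) {f : X → ℝ}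
    (hf : MemLpZero m ν Ω p f) : f =ᵐ[ν.restrict (cl m Ω)] Ω.indicator f := by
  rw [Filter.EventuallyEq, ae_restrict_iff' (measurableSet_cl m hΩ)]
  filter_upwards [(ae_restrict_iff' (measurableSet_bdry m hΩ)).1 hf.2] with x hx hxc
  by_cases h : x ∈ Ω
  · rw [indicator_of_mem h]
  · rw [indicator_of_notMem h, hx (hxc.resolve_left h)]

lemma setIntegral_cl_indicator (hΩ : MeasurableSet Ω) (f : X → ℝ) :
    ∫ x in cl m Ω, Ω.indicator f x ∂ν = ∫ x in Ω, f x ∂ν := by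
  rw [integral_indicator hΩ, Measure.restrict_restrict hΩ,
    inter_eq_self_of_subset_left (subset_cl m Ω)]

lemma memLpZero_indicator (hΩ : MeasurableSet Ω) {f : X → ℝ}
    (hf : MemLp f (ENNReal.ofReal p) (ν.restrict Ω)) : MemLpZero m ν Ω p (Ω.indicator f) := by
  refine ⟨?_, ?_⟩
  · rwa [memLp_indicator_iff_restrict hΩ, Measure.restrict_restrict hΩ,
      inter_eq_self_of_subset_left (subset_cl m Ω)]
  · refine (ae_restrict_iff' (measurableSet_bdry m hΩ)).2 (ae_of_all _ fun x hx => ?_)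
    exact indicator_of_notMem hx.1 _

lemma memLpZero_indicator_one (hΩ : MeasurableSet Ω) (hfin : ν (cl m Ω) < ⊤)
    {A : Set X} (hA : MeasurableSet A) (hAΩ : A ⊆ Ω) :
    MemLpZero m ν Ω p (A.indicator fun _ => 1) := by
  have : IsFiniteMeasure (ν.restrict Ω) :=
    ⟨by simpa using (measure_mono (subset_cl m Ω)).trans_lt hfin⟩
  have h := memLpZero_indicator (m := m) (p := p) hΩ
    ((memLp_const (μ := ν.restrict Ω) (1 : ℝ)).indicator hA)
  rwa [indicator_indicator, inter_eq_self_of_subset_right hAΩ] at h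

variable [IsMarkovKernel m] [SigmaFinite ν]

lemma integrable_pLaplacian_mul (hp : 1 < p) (hrev : m.IsReversible ν) (hΩ : MeasurableSet Ω)
    (hfin : ν (cl m Ω) < ⊤) {f h : X → ℝ}
    (hf : MemLp f (ENNReal.ofReal p) (ν.restrict (cl m Ω)))
    (hh : MemLp h (ENNReal.ofReal p) (ν.restrict (cl m Ω))) :
    Integrable (fun x => pLaplacian m Ω p f x * h x) (ν.restrict (cl m Ω)) ∧
      ∫ z, oddPow p (grad f z) * h z.1 ∂(pairMeasure m ν Ω) =
        ∫ x in cl m Ω, pLaplacian m Ω p f x * h x ∂ν := by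
  have hc := measurableSet_cl m hΩ
  have hfst := map_fst_pairMeasure_le (m := m) (ν := ν) hΩ
  have hsnd := map_snd_pairMeasure_le hrev hΩ hfin
  have hint := integrable_oddPow_mul hp (memLp_grad hfst hsnd hf) (memLp_comp_fst hfst hh).1
  have heq : ∀ x, ∫ y in cl m Ω, oddPow p (grad f (x, y)) * h x ∂(m x)
      = pLaplacian m Ω p f x * h x := fun x => integral_mul_const _ _
  constructor
  · have hi := hint
    rw [pairMeasure, ← IntegrableOn, ← integrable_indicator_iff (hc.prod hc),
      Measure.compProd] at hi
    have h2 := hi.integral_compProd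
    rw [← IntegrableOn, ← integrable_indicator_iff hc]
    refine h2.congr (ae_of_all _ fun x => ?_)
    by_cases hx : x ∈ cl m Ω
    · rw [indicator_of_mem hx, ← heq, ← integral_indicator hc]
      refine integral_congr_ae (ae_of_all _ fun y => ?_)
      by_cases hy : y ∈ cl m Ω <;> simp [indicator, hx, hy]
    · simp [indicator, hx]
  · rw [pairMeasure, Measure.setIntegral_compProd hc hc hint]
    simp only [heq]

/-- The weak formulation of the torsion problem. -/
lemma IsTorsional.weak (hp : 1 < p) (hrev : m.IsReversible ν) (hΩ : MeasurableSet Ω)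
    (hfin : ν (cl m Ω) < ⊤) {f h : X → ℝ} (hf : IsTorsional m ν Ω p f)
    (hh : MemLpZero m ν Ω p h) :
    ∫ z, oddPow p (grad f z) * grad h z ∂(pairMeasure m ν Ω) = 2 * ∫ x in Ω, h x ∂ν := by
  have hc := measurableSet_cl m hΩ
  have hfst := map_fst_pairMeasure_le (m := m) (ν := ν) hΩ
  have hsnd := map_snd_pairMeasure_le hrev hΩ hfin
  rw [integral_oddPow_grad_mul_grad hp hfst (map_swap_pairMeasure hrev hΩ hfin)
    (memLp_grad hfst hsnd hf.1.1) hh.1, (integrable_pLaplacian_mul hp hrev hΩ hfin hf.1.1 hh.1).2,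
    ← setIntegral_cl_indicator (m := m) hΩ h]
  have : ∫ x in cl m Ω, pLaplacian m Ω p f x * h x ∂ν
      = ∫ x in cl m Ω, -Ω.indicator h x ∂ν := by
    refine integral_congr_ae ?_
    have h1 := ae_restrict_of_ae (s := cl m Ω) ((ae_restrict_iff' hΩ).1 hf.2)
    filter_upwards [h1, hh.ae_eq_indicator hΩ] with x hx1 hx2
    by_cases hx : x ∈ Ω
    · rw [indicator_of_mem hx, neg_eq_iff_eq_neg.1 (hx1 hx)]
      ring
    · rw [hx2, indicator_of_notMem hx]; simp
  rw [this, integral_neg]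
  ring

lemma isTorsional_of_weak (hp : 1 < p) (hrev : m.IsReversible ν) (hΩ : MeasurableSet Ω)
    (hfin : ν (cl m Ω) < ⊤) {f : X → ℝ} (hf : MemLpZero m ν Ω p f)
    (hweak : ∀ h : X → ℝ, MemLpZero m ν Ω p h →
      ∫ z, oddPow p (grad f z) * grad h z ∂(pairMeasure m ν Ω) = 2 * ∫ x in Ω, h x ∂ν) :
    IsTorsional m ν Ω p f := by
  have hc := measurableSet_cl m hΩ
  have hfst := map_fst_pairMeasure_le (m := m) (ν := ν) hΩ
  have hsnd := map_snd_pairMeasure_le hrev hΩ hfin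
  have hle : ν.restrict Ω ≤ ν.restrict (cl m Ω) := Measure.restrict_mono_set ν (subset_cl m Ω)
  have : IsFiniteMeasure (ν.restrict (cl m Ω)) := ⟨by simpa using hfin⟩
  have : IsFiniteMeasure (ν.restrict Ω) := isFiniteMeasure_of_le _ hle
  refine ⟨hf, ?_⟩
  have hint := (integrable_pLaplacian_mul hp hrev hΩ hfin hf.1
    (memLp_const (1 : ℝ))).1
  simp only [mul_one] at hint
  refine Integrable.ae_eq_of_forall_setIntegral_eq _ _ (hint.mono_measure hle).neg
    (integrable_const _) fun A hA _ => ?_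
  have hmem := memLpZero_indicator_one (m := m) (p := p) hΩ hfin (hA.inter hΩ) inter_subset_right
  have h1 := hweak _ hmem
  rw [integral_oddPow_grad_mul_grad hp hfst (map_swap_pairMeasure hrev hΩ hfin)
    (memLp_grad hfst hsnd hf.1) hmem.1, (integrable_pLaplacian_mul hp hrev hΩ hfin hf.1 hmem.1).2]
    at h1
  have h2 : ∀ x, pLaplacian m Ω p f x * (A ∩ Ω).indicator (fun _ => 1) x
      = Ω.indicator (A.indicator fun x => pLaplacian m Ω p f x) x := fun x => by
    by_cases hx : x ∈ A <;> by_cases hx' : x ∈ Ω <;> simp [indicator, hx, hx']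
  have h3 : ∀ x, (A ∩ Ω).indicator (fun _ => (1 : ℝ)) x
      = Ω.indicator (A.indicator fun _ => 1) x := fun x => by
    by_cases hx : x ∈ A <;> by_cases hx' : x ∈ Ω <;> simp [indicator, hx, hx']
  rw [integral_congr_ae (ae_of_all _ h2), integral_congr_ae (ae_of_all _ h3)] at h1
  rw [setIntegral_cl_indicator hΩ, integral_indicator hA, integral_indicator hΩ,
    Measure.restrict_restrict hΩ, inter_self, integral_indicator hA] at h1
  rw [integral_neg]
  linarith

end WeakFormulation

section Minimization

lemma exists_forall_le_of_cauchy {V : Type*} [MetricSpace V] [CompleteSpace V] [Nonempty V]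
    {J : V → ℝ} (hJ : Continuous J) (hbdd : BddBelow (range J))
    (hcauchy : ∀ ε > 0, ∃ δ > 0, ∀ u v, J u < iInf J + δ → J v < iInf J + δ → dist u v < ε) :
    ∃ u, ∀ v, J u ≤ J v := by
  have hex : ∀ n : ℕ, ∃ u, J u < iInf J + 1 / ((n : ℝ) + 1) := fun n =>
    exists_lt_of_ciInf_lt (lt_add_of_pos_right _ Nat.one_div_pos_of_nat)
  choose u hu using hex
  have hmono : ∀ n k : ℕ, n ≤ k → J (u k) < iInf J + 1 / ((n : ℝ) + 1) := fun n k h =>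
    (hu k).trans_le (by gcongr)
  have hc : CauchySeq u := by
    refine Metric.cauchySeq_iff.2 fun ε hε => ?_
    obtain ⟨δ, hδ, h⟩ := hcauchy ε hε
    obtain ⟨n, hn⟩ := exists_nat_one_div_lt hδ
    exact ⟨n, fun k hk l hl => h _ _ ((hmono n k hk).trans (by gcongr))
      ((hmono n l hl).trans (by gcongr))⟩
  obtain ⟨w, hw⟩ := cauchySeq_tendsto_of_complete hc
  have h1 : Tendsto (fun n => J (u n)) atTop (𝓝 (J w)) := (hJ.tendsto w).comp hw
  have h2 : Tendsto (fun n : ℕ => iInf J + 1 / ((n : ℝ) + 1)) atTop (𝓝 (iInf J)) := by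
    simpa using tendsto_one_div_add_atTop_nhds_zero_nat.const_add (iInf J)
  exact ⟨w, fun v => (le_of_tendsto_of_tendsto' h1 h2 fun n => (hu n).le).trans (ciInf_le hbdd v)⟩

variable {p : ℝ} {Y : Type*} [MeasurableSpace Y] {Q : Measure Y}

lemma norm_toLp_rpow (hp : 1 < p) {F : Y → ℝ} (hF : MemLp F (ENNReal.ofReal p) Q) :
    ‖hF.toLp F‖ ^ p = ∫ z, |F z| ^ p ∂Q := by
  have hp0 : 0 < p := by linarith
  have h := hF.eLpNorm_eq_integral_rpow_norm (by simpa using hp0) ENNReal.ofReal_ne_top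
  have hnn : 0 ≤ ∫ z, |F z| ^ p ∂Q := integral_nonneg fun z => by positivity
  rw [ENNReal.toReal_ofReal hp0.le] at h
  rw [Lp.norm_toLp, h, ENNReal.toReal_ofReal (by positivity)]
  simp only [Real.norm_eq_abs]
  rw [← Real.rpow_mul hnn, inv_mul_cancel₀ hp0.ne', Real.rpow_one]

lemma norm_rpow_eq_integral (hp : 1 < p) (F : Lp ℝ (ENNReal.ofReal p) Q) :
    ‖F‖ ^ p = ∫ z, |F z| ^ p ∂Q := by
  rw [← norm_toLp_rpow hp (Lp.memLp F), Lp.toLp_coeFn]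

lemma norm_sub_rpow_eq_integral (hp : 1 < p) (F G : Lp ℝ (ENNReal.ofReal p) Q) :
    ‖F - G‖ ^ p = ∫ z, |F z - G z| ^ p ∂Q := by
  rw [norm_rpow_eq_integral hp]
  refine integral_congr_ae ?_
  filter_upwards [Lp.coeFn_sub F G] with z hz
  rw [hz, Pi.sub_apply]

/-- Uniform convexity of the `p`-th power of the norm of `L^p`. -/
lemma exists_norm_sub_rpow_le [Fact (1 ≤ ENNReal.ofReal p)] (hp : 1 < p) {ε : ℝ} (hε : 0 < ε) :
    ∃ C : ℝ, 0 ≤ C ∧ ∀ F G : Lp ℝ (ENNReal.ofReal p) Q,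
      ‖F - G‖ ^ p ≤ C * ((‖F‖ ^ p + ‖G‖ ^ p) / 2 - ‖(1 / 2 : ℝ) • (F + G)‖ ^ p)
        + ε * (‖F‖ ^ p + ‖G‖ ^ p) := by
  obtain ⟨C, hC, h⟩ := exists_abs_sub_rpow_le hp hε
  refine ⟨C, hC, fun F G => ?_⟩
  have hF := integrable_abs_rpow hp (Lp.memLp F)
  have hG := integrable_abs_rpow hp (Lp.memLp G)
  have hFG : Integrable (fun z => |F z| ^ p + |G z| ^ p) Q := hF.add hG
  have hm : ((1 / 2 : ℝ) • (F + G) : Lp ℝ (ENNReal.ofReal p) Q) =ᵐ[Q]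
      fun z => (F z + G z) / 2 := by
    filter_upwards [Lp.coeFn_smul (1 / 2 : ℝ) (F + G), Lp.coeFn_add F G] with z h1 h2
    rw [h1, Pi.smul_apply, h2, Pi.add_apply, smul_eq_mul]
    ring
  have hM : Integrable (fun z => |(F z + G z) / 2| ^ p) Q :=
    (integrable_abs_rpow hp (Lp.memLp ((1 / 2 : ℝ) • (F + G)))).congr
      (hm.mono fun z hz => by simp only [hz])
  have hS : Integrable (fun z => |F z - G z| ^ p) Q :=
    integrable_abs_rpow hp ((Lp.memLp F).sub (Lp.memLp G))
  have hMeq : ‖(1 / 2 : ℝ) • (F + G)‖ ^ p = ∫ z, |(F z + G z) / 2| ^ p ∂Q := by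
    rw [norm_rpow_eq_integral hp]
    exact integral_congr_ae (hm.mono fun z hz => by simp only [hz])
  have hD : Integrable (fun z => (|F z| ^ p + |G z| ^ p) / 2 - |(F z + G z) / 2| ^ p) Q :=
    (hFG.div_const 2).sub hM
  rw [norm_sub_rpow_eq_integral hp, hMeq, norm_rpow_eq_integral hp F, norm_rpow_eq_integral hp G,
    ← integral_add hF hG, ← integral_div, ← integral_sub (hFG.div_const 2) hM,
    ← integral_const_mul, ← integral_const_mul,
    ← integral_add (hD.const_mul C) (hFG.const_mul ε)]
  exact integral_mono hS ((hD.const_mul C).add (hFG.const_mul ε)) fun z => h _ _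

lemma tendsto_integral_oddPow_add_mul (hp : 1 < p) {F G : Y → ℝ}
    (hF : MemLp F (ENNReal.ofReal p) Q) (hG : MemLp G (ENNReal.ofReal p) Q) :
    Tendsto (fun n : ℕ => ∫ z, oddPow p (F z + 1 / ((n : ℝ) + 1) * G z) * G z ∂Q) atTop
      (𝓝 (∫ z, oddPow p (F z) * G z ∂Q)) := by
  have hp0 : 0 < p := by linarith
  refine tendsto_integral_of_dominated_convergence (fun z => (|F z| + |G z|) ^ p + |G z| ^ p)
    (fun n => (integrable_oddPow_mul hp (hF.add (hG.const_mul _)) hG).1) ?_ (fun n => ?_) ?_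
  · refine Integrable.add ?_ (integrable_abs_rpow hp hG)
    refine (integrable_abs_rpow hp (hF.norm.add hG.norm)).congr (ae_of_all _ fun z => ?_)
    simp only [Pi.add_apply, Real.norm_eq_abs]
    rw [abs_of_nonneg (by positivity : 0 ≤ |F z| + |G z|)]
  · refine ae_of_all _ fun z => (abs_oddPow_mul_le hp _ _).trans ?_
    gcongr
    refine (abs_add_le _ _).trans ?_
    rw [abs_mul, abs_of_nonneg (by positivity : 0 ≤ 1 / ((n : ℝ) + 1))]
    gcongr
    refine mul_le_of_le_one_left (abs_nonneg _) ?_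
    rw [div_le_one (by positivity)]
    linarith [Nat.cast_nonneg (α := ℝ) n]
  · refine ae_of_all _ fun z => Tendsto.mul_const _ ?_
    refine ((continuous_oddPow hp).tendsto (F z)).comp ?_
    simpa using (tendsto_one_div_add_atTop_nhds_zero_nat.mul_const (G z)).const_add (F z)

lemma integral_abs_add_rpow_sub_le (hp : 1 < p) {F G : Y → ℝ}
    (hF : MemLp F (ENNReal.ofReal p) Q) (hG : MemLp G (ENNReal.ofReal p) Q) (t : ℝ) :
    ∫ z, |F z + t * G z| ^ p ∂Q - p * t * ∫ z, oddPow p (F z + t * G z) * G z ∂Q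
      ≤ ∫ z, |F z| ^ p ∂Q := by
  have hsum : MemLp (fun z => F z + t * G z) (ENNReal.ofReal p) Q := hF.add (hG.const_mul _)
  have h1 := integrable_abs_rpow hp hsum
  have h2 := (integrable_oddPow_mul hp hsum hG).const_mul (p * t)
  rw [← integral_const_mul, ← integral_sub h1 h2]
  refine integral_mono (h1.sub h2) (integrable_abs_rpow hp hF) fun z => ?_
  refine le_trans (le_of_eq ?_) (abs_rpow_add_le hp (F z + t * G z) (F z))
  simp only
  ring

variable {E : Type*} [NormedAddCommGroup E] [NormedSpace ℝ E]
  [Fact (1 ≤ ENNReal.ofReal p)]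

/-- The functional `‖D u‖^p / p - ℓ u` attains its minimum. -/
lemma exists_minimizer [CompleteSpace E] (hp : 1 < p) (D : E →L[ℝ] Lp ℝ (ENNReal.ofReal p) Q)
    (ℓ : E →L[ℝ] ℝ) {c : ℝ} (hc : 0 < c) (hD : ∀ u, c * ‖u‖ ^ p ≤ ‖D u‖ ^ p) :
    ∃ u, ∀ v, ‖D u‖ ^ p / p - ℓ u ≤ ‖D v‖ ^ p / p - ℓ v := by
  have hp0 : 0 < p := by linarith
  set J : E → ℝ := fun u => ‖D u‖ ^ p / p - ℓ u with hJ
  have hJc : Continuous J :=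
    (((D.continuous.norm).rpow_const fun _ => Or.inr hp0.le).div_const p).sub ℓ.continuous
  obtain ⟨C₀, hC₀⟩ := exists_le_mul_rpow_add hp
    (η := c / (2 * p * (‖ℓ‖ ^ p + 1))) (by positivity)
  have hcoer : ∀ u, ‖D u‖ ^ p / (2 * p) - C₀ ≤ J u := fun u => by
    have h1 : ℓ u ≤ ‖ℓ‖ * ‖u‖ := (le_abs_self _).trans (ℓ.le_opNorm u)
    have h2 := hC₀ (‖ℓ‖ * ‖u‖) (by positivity)
    rw [Real.mul_rpow (norm_nonneg _) (norm_nonneg _)] at h2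
    have h3 : c / (2 * p * (‖ℓ‖ ^ p + 1)) * (‖ℓ‖ ^ p * ‖u‖ ^ p) ≤ ‖D u‖ ^ p / (2 * p) := by
      calc _ = (‖ℓ‖ ^ p / (‖ℓ‖ ^ p + 1)) * ((c * ‖u‖ ^ p) / (2 * p)) := by field_simp
        _ ≤ 1 * (‖D u‖ ^ p / (2 * p)) := by
          gcongr
          · rw [div_le_one (by positivity)]; linarith
          · exact hD u
        _ = _ := one_mul _
    have h4 : ‖D u‖ ^ p / p = ‖D u‖ ^ p / (2 * p) + ‖D u‖ ^ p / (2 * p) := by field_simp; ring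
    simp only [hJ, h4]
    linarith
  have hbdd : BddBelow (range J) := ⟨-C₀, by
    rintro _ ⟨u, rfl⟩
    have : 0 ≤ ‖D u‖ ^ p / (2 * p) := by positivity
    linarith [hcoer u]⟩
  refine exists_forall_le_of_cauchy hJc hbdd fun ε hε => ?_
  set M := max (2 * p * (iInf J + 1 + C₀)) 1 with hM
  have hM0 : 0 < M := lt_max_of_lt_right one_pos
  set κ := c * ε ^ p with hκ
  have hκ0 : 0 < κ := by positivity
  obtain ⟨C, hC, hconv⟩ := exists_norm_sub_rpow_le (Q := Q) hp (ε := κ / (4 * M)) (by positivity)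
  refine ⟨min 1 (κ / (4 * p * (C + 1))), by positivity, fun u v hu hv => ?_⟩
  have hbound : ∀ w, J w < iInf J + min 1 (κ / (4 * p * (C + 1))) → ‖D w‖ ^ p ≤ M := fun w hw => by
    have h1 := (hcoer w).trans (hw.le.trans (add_le_add_right (min_le_left _ _) _))
    refine le_trans ?_ (le_max_left _ _)
    rw [sub_le_iff_le_add, div_le_iff₀ (by positivity)] at h1
    linarith
  have hmid : (‖D u‖ ^ p + ‖D v‖ ^ p) / 2 - ‖(1 / 2 : ℝ) • (D u + D v)‖ ^ p
      ≤ p * (κ / (4 * p * (C + 1))) := by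
    have h1 : iInf J ≤ J ((1 / 2 : ℝ) • (u + v)) := ciInf_le hbdd _
    have h2 := hu.trans_le (add_le_add_right (min_le_right _ _) _)
    have h3 := hv.trans_le (add_le_add_right (min_le_right _ _) _)
    simp only [hJ, map_smul, map_add, smul_eq_mul] at h1 h2 h3
    have h4 : ((‖D u‖ ^ p + ‖D v‖ ^ p) / 2 - ‖(1 / 2 : ℝ) • (D u + D v)‖ ^ p) / p
        ≤ κ / (4 * p * (C + 1)) := by
      have : ((‖D u‖ ^ p + ‖D v‖ ^ p) / 2 - ‖(1 / 2 : ℝ) • (D u + D v)‖ ^ p) / p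
        = (‖D u‖ ^ p / p + ‖D v‖ ^ p / p) / 2 - ‖(1 / 2 : ℝ) • (D u + D v)‖ ^ p / p := by ring
      rw [this]
      linarith
    rwa [div_le_iff₀' hp0] at h4
  have hmain : c * ‖u - v‖ ^ p < κ := by
    calc c * ‖u - v‖ ^ p ≤ ‖D u - D v‖ ^ p := by rw [← map_sub]; exact hD _
      _ ≤ C * (p * (κ / (4 * p * (C + 1)))) + κ / (4 * M) * (M + M) := by
        refine (hconv _ _).trans ?_
        gcongr
        · exact hbound u hu
        · exact hbound v hv
      _ = C / (C + 1) * (κ / 4) + κ / 2 := by field_simp; ring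
      _ ≤ 1 * (κ / 4) + κ / 2 := by
        gcongr
        rw [div_le_one (by positivity)]; linarith
      _ < κ := by linarith
  rw [dist_eq_norm]
  exact (Real.rpow_lt_rpow_iff (norm_nonneg _) hε.le hp0).1 (lt_of_mul_lt_mul_left hmain hc.le)

/-- The Euler-Lagrange inequality of a minimizer of `‖D u‖^p / p - ℓ u`. -/
lemma le_integral_oddPow_mul (hp : 1 < p) (D : E →L[ℝ] Lp ℝ (ENNReal.ofReal p) Q)
    (ℓ : E →L[ℝ] ℝ) {u : E} (hu : ∀ v, ‖D u‖ ^ p / p - ℓ u ≤ ‖D v‖ ^ p / p - ℓ v) (h : E) :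
    ℓ h ≤ ∫ z, oddPow p (D u z) * D h z ∂Q := by
  have hp0 : 0 < p := by linarith
  refine ge_of_tendsto' (tendsto_integral_oddPow_add_mul hp (Lp.memLp _) (Lp.memLp _)) fun n => ?_
  set t : ℝ := 1 / ((n : ℝ) + 1) with ht
  have ht0 : 0 < t := by positivity
  have h1 := hu (u + t • h)
  have hae : (D (u + t • h) : Y → ℝ) =ᵐ[Q] fun z => D u z + t * D h z := by
    rw [map_add, map_smul]
    filter_upwards [Lp.coeFn_add (D u) (t • D h), Lp.coeFn_smul t (D h)] with z h1 h2
    rw [h1, Pi.add_apply, h2, Pi.smul_apply, smul_eq_mul]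
  have hnorm : ‖D (u + t • h)‖ ^ p = ∫ z, |D u z + t * D h z| ^ p ∂Q := by
    rw [norm_rpow_eq_integral hp]
    exact integral_congr_ae (hae.mono fun z hz => by simp only [hz])
  have h2 := integral_abs_add_rpow_sub_le hp (Lp.memLp (D u)) (Lp.memLp (D h)) t
  rw [← hnorm, ← norm_rpow_eq_integral hp] at h2
  rw [map_add ℓ, map_smul ℓ, smul_eq_mul] at h1
  have h3 : ‖D (u + t • h)‖ ^ p / p - t * ∫ z, oddPow p (D u z + t * D h z) * D h z ∂Q
      ≤ ‖D u‖ ^ p / p := by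
    rw [le_div_iff₀ hp0, sub_mul, div_mul_cancel₀ _ hp0.ne']
    linarith
  refine le_of_mul_le_mul_left ?_ ht0
  linarith

/-- Weak solvability of the `p`-Laplace type equation attached to `D`. -/
lemma exists_forall_integral_oddPow_eq [CompleteSpace E] (hp : 1 < p)
    (D : E →L[ℝ] Lp ℝ (ENNReal.ofReal p) Q) (ℓ : E →L[ℝ] ℝ) {c : ℝ} (hc : 0 < c)
    (hD : ∀ u, c * ‖u‖ ^ p ≤ ‖D u‖ ^ p) :
    ∃ u, ∀ h, ∫ z, oddPow p (D u z) * D h z ∂Q = ℓ h := by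
  obtain ⟨u, hu⟩ := exists_minimizer hp D ℓ hc hD
  refine ⟨u, fun h => le_antisymm ?_ (le_integral_oddPow_mul hp D ℓ hu h)⟩
  have h1 := le_integral_oddPow_mul hp D ℓ hu (-h)
  have h2 : ∫ z, oddPow p (D u z) * D (-h) z ∂Q = -∫ z, oddPow p (D u z) * D h z ∂Q := by
    rw [← integral_neg]
    refine integral_congr_ae ?_
    rw [map_neg]
    filter_upwards [Lp.coeFn_neg (D h)] with z hz
    rw [hz, Pi.neg_apply, mul_neg]
  rw [h2, map_neg] at h1
  linarith

end Minimization

section Existence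

variable {X : Type*} [MeasurableSpace X] {m : Kernel X X} {ν : Measure X} {Ω : Set X} {p : ℝ}

lemma indicator_ae_eq (hΩ : MeasurableSet Ω) {f g : X → ℝ} (h : f =ᵐ[ν.restrict Ω] g) :
    Ω.indicator f =ᵐ[ν.restrict (cl m Ω)] Ω.indicator g := by
  refine ae_restrict_of_ae ?_
  filter_upwards [(ae_restrict_iff' hΩ).1 h] with x hx
  by_cases hxΩ : x ∈ Ω
  · rw [indicator_of_mem hxΩ, indicator_of_mem hxΩ, hx hxΩ]
  · rw [indicator_of_notMem hxΩ, indicator_of_notMem hxΩ]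

variable [IsMarkovKernel m] [SigmaFinite ν]

/-- The nonlocal gradient of the extension by zero, as an operator from `L^p(Ω, ν)` to
`L^p(ν ⊗ m_x)`. -/
lemma exists_gradLp [Fact (1 ≤ ENNReal.ofReal p)] (hrev : m.IsReversible ν)
    (hΩ : MeasurableSet Ω) (hfin : ν (cl m Ω) < ⊤) :
    ∃ D : Lp ℝ (ENNReal.ofReal p) (ν.restrict Ω) →L[ℝ]
        Lp ℝ (ENNReal.ofReal p) (pairMeasure m ν Ω),
      ∀ u, D u =ᵐ[pairMeasure m ν Ω] grad (Ω.indicator u) := by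
  have hfst := map_fst_pairMeasure_le (m := m) (ν := ν) hΩ
  have hsnd := map_snd_pairMeasure_le hrev hΩ hfin
  have hz : ∀ u : Lp ℝ (ENNReal.ofReal p) (ν.restrict Ω), MemLpZero m ν Ω p (Ω.indicator u) :=
    fun u => memLpZero_indicator hΩ (Lp.memLp u)
  have hmem : ∀ u : Lp ℝ (ENNReal.ofReal p) (ν.restrict Ω),
      MemLp (grad (Ω.indicator u)) (ENNReal.ofReal p) (pairMeasure m ν Ω) :=
    fun u => memLp_grad hfst hsnd (hz u).1
  let L : Lp ℝ (ENNReal.ofReal p) (ν.restrict Ω) →ₗ[ℝ]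
      Lp ℝ (ENNReal.ofReal p) (pairMeasure m ν Ω) :=
    { toFun := fun u => (hmem u).toLp _
      map_add' := fun u v => by
        rw [← MemLp.toLp_add, MemLp.toLp_eq_toLp_iff]
        refine (grad_ae_eq hfst hsnd (indicator_ae_eq hΩ (Lp.coeFn_add u v))).trans ?_
        refine ae_of_all _ fun z => ?_
        simp only [grad, Pi.add_apply, indicator_add']
        ring
      map_smul' := fun c u => by
        rw [← MemLp.toLp_const_smul, MemLp.toLp_eq_toLp_iff]
        refine (grad_ae_eq hfst hsnd (indicator_ae_eq hΩ (Lp.coeFn_smul c u))).trans ?_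
        refine ae_of_all _ fun z => ?_
        simp only [grad, RingHom.id_apply, Pi.smul_apply, smul_eq_mul]
        by_cases h1 : z.1 ∈ Ω <;> by_cases h2 : z.2 ∈ Ω <;> simp [h1, h2, mul_sub] }
  refine ⟨L.mkContinuous 2 fun u => ?_, fun u => (hmem u).coeFn_toLp⟩
  have h1 := eLpNorm_grad_le hfst hsnd Fact.out (hz u).1
  rw [eLpNorm_indicator_eq_eLpNorm_restrict hΩ, Measure.restrict_restrict hΩ,
    inter_eq_self_of_subset_left (subset_cl m Ω)] at h1
  change ‖(hmem u).toLp _‖ ≤ _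
  rw [Lp.norm_toLp, Lp.norm_def]
  have h2 := ENNReal.toReal_mono (by finiteness [Lp.eLpNorm_ne_top u]) h1
  rwa [ENNReal.toReal_mul, ENNReal.toReal_ofNat] at h2

lemma exists_isTorsional (hp : 1 < p) (hrev : m.IsReversible ν) (hΩ : MeasurableSet Ω)
    (hfin : ν (cl m Ω) < ⊤) (hP : Poincare m ν Ω p) : ∃ f : X → ℝ, IsTorsional m ν Ω p f := by
  have hfact : Fact (1 ≤ ENNReal.ofReal p) := ⟨by simpa using hp.le⟩
  have hfinΩ : IsFiniteMeasure (ν.restrict Ω) :=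
    ⟨by simpa using (measure_mono (subset_cl m Ω)).trans_lt hfin⟩
  have hfst := map_fst_pairMeasure_le (m := m) (ν := ν) hΩ
  have hsnd := map_snd_pairMeasure_le hrev hΩ hfin
  obtain ⟨c, hc, hP⟩ := hP
  obtain ⟨D, hD⟩ := exists_gradLp (p := p) hrev hΩ hfin
  have hint : ∀ u : Lp ℝ (ENNReal.ofReal p) (ν.restrict Ω), Integrable u (ν.restrict Ω) :=
    fun u => (Lp.memLp u).integrable hfact.out
  let ℓ₀ : Lp ℝ (ENNReal.ofReal p) (ν.restrict Ω) →ₗ[ℝ] ℝ :=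
    { toFun := fun u => 2 * ∫ x in Ω, u x ∂ν
      map_add' := fun u v => by
        rw [integral_congr_ae (Lp.coeFn_add u v), integral_add' (hint u) (hint v), mul_add]
      map_smul' := fun a u => by
        rw [integral_congr_ae (Lp.coeFn_smul a u)]
        simp only [Pi.smul_apply, smul_eq_mul, RingHom.id_apply, integral_const_mul]
        ring }
  have hℓ : ∃ C, ∀ u, ‖ℓ₀ u‖ ≤ C * ‖u‖ := by
    set K := (ν.restrict Ω) univ ^ (1 / (1 : ENNReal).toReal - 1 / (ENNReal.ofReal p).toReal)
      with hK
    have hKtop : K ≠ ⊤ := by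
      refine ENNReal.rpow_ne_top_of_nonneg ?_ (measure_ne_top _ _)
      rw [ENNReal.toReal_ofReal (by linarith), ENNReal.toReal_one, div_one, sub_nonneg,
        div_le_one (by linarith)]
      exact hp.le
    refine ⟨2 * K.toReal, fun u => ?_⟩
    have h1 : ‖∫ x in Ω, u x ∂ν‖ₑ ≤ eLpNorm u (ENNReal.ofReal p) (ν.restrict Ω) * K := by
      refine (enorm_integral_le_lintegral_enorm _).trans ?_
      rw [← eLpNorm_one_eq_lintegral_enorm]
      exact eLpNorm_le_eLpNorm_mul_rpow_measure_univ hfact.out (Lp.aestronglyMeasurable u)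
    have h2 := ENNReal.toReal_mono (ENNReal.mul_ne_top (Lp.eLpNorm_ne_top u) hKtop) h1
    rw [toReal_enorm, ENNReal.toReal_mul, ← Lp.norm_def] at h2
    change ‖2 * ∫ x in Ω, u x ∂ν‖ ≤ _
    rw [norm_mul, Real.norm_ofNat]
    linarith
  obtain ⟨C, hC⟩ := hℓ
  obtain ⟨u, hu⟩ := exists_forall_integral_oddPow_eq hp D (ℓ₀.mkContinuous C hC) hc fun u => by
    have h1 := hP _ (memLpZero_indicator hΩ (Lp.memLp u))
    rw [norm_rpow_eq_integral hp, norm_rpow_eq_integral hp,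
      integral_congr_ae ((hD u).mono fun z hz => by simp only [hz] :
        (fun z => |D u z| ^ p) =ᵐ[_] fun z => |grad (Ω.indicator u) z| ^ p)]
    refine le_trans (le_of_eq ?_) h1
    congr 1
    refine setIntegral_congr_fun hΩ fun x hx => ?_
    simp only [indicator_of_mem hx]
  refine ⟨Ω.indicator u, isTorsional_of_weak hp hrev hΩ hfin
    (memLpZero_indicator hΩ (Lp.memLp u)) fun h hh => ?_⟩
  have hhΩ : MemLp h (ENNReal.ofReal p) (ν.restrict Ω) :=
    hh.1.mono_measure (Measure.restrict_mono_set ν (subset_cl m Ω))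
  have h1 := hu (hhΩ.toLp h)
  have h2 : ℓ₀.mkContinuous C hC (hhΩ.toLp h) = 2 * ∫ x in Ω, h x ∂ν := by
    change 2 * ∫ x in Ω, hhΩ.toLp h x ∂ν = _
    rw [integral_congr_ae hhΩ.coeFn_toLp]
  rw [← h2, ← h1]
  refine integral_congr_ae ?_
  have h3 := grad_ae_eq hfst hsnd
    ((indicator_ae_eq hΩ hhΩ.coeFn_toLp).trans (hh.ae_eq_indicator hΩ).symm)
  filter_upwards [hD u, hD (hhΩ.toLp h), h3] with z h4 h5 h6
  rw [h4, h5, h6]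

end Existence

section Uniqueness

variable {X : Type*} [MeasurableSpace X] {m : Kernel X X} {ν : Measure X} {Ω : Set X} {p : ℝ}
  [IsMarkovKernel m] [SigmaFinite ν]

lemma IsTorsional.ae_eq (hp : 1 < p) (hrev : m.IsReversible ν) (hΩ : MeasurableSet Ω)
    (hfin : ν (cl m Ω) < ⊤) (hP : Poincare m ν Ω p) {f g : X → ℝ} (hf : IsTorsional m ν Ω p f)
    (hg : IsTorsional m ν Ω p g) : f =ᵐ[ν.restrict (cl m Ω)] g := by
  have hp0 : 0 < p := by linarith
  have hfst := map_fst_pairMeasure_le (m := m) (ν := ν) hΩ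
  have hsnd := map_snd_pairMeasure_le hrev hΩ hfin
  have hh : MemLpZero m ν Ω p (f - g) := by
    refine ⟨hf.1.1.sub hg.1.1, ?_⟩
    filter_upwards [hf.1.2, hg.1.2] with x h1 h2
    simp [h1, h2]
  have hgrad : ∀ z, grad (f - g) z = grad f z - grad g z := fun z => by
    simp only [grad, Pi.sub_apply]; ring
  have hgh := memLp_grad hfst hsnd hh.1
  have hif := integrable_oddPow_mul hp (memLp_grad hfst hsnd hf.1.1) hgh
  have hig := integrable_oddPow_mul hp (memLp_grad hfst hsnd hg.1.1) hgh
  have h0 : ∫ z, (oddPow p (grad f z) * grad (f - g) z - oddPow p (grad g z) * grad (f - g) z)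
      ∂(pairMeasure m ν Ω) = 0 := by
    rw [integral_sub hif hig, hf.weak hp hrev hΩ hfin hh, hg.weak hp hrev hΩ hfin hh, sub_self]
  have hae : ∀ᵐ z ∂(pairMeasure m ν Ω), grad (f - g) z = 0 := by
    have hsub : Integrable (fun z => oddPow p (grad f z) * grad (f - g) z
      - oddPow p (grad g z) * grad (f - g) z) (pairMeasure m ν Ω) := hif.sub hig
    rw [integral_eq_zero_iff_of_nonneg (fun z => ?_) hsub] at h0
    · filter_upwards [h0] with z hz
      rw [hgrad, sub_eq_zero]
      refine eq_of_oddPow_sub_mul_sub_nonpos hp ?_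
      rw [← hgrad, sub_mul]
      exact hz.le
    · simp only [Pi.zero_apply, ← sub_mul, hgrad]
      exact oddPow_sub_mul_sub_nonneg hp _ _
  obtain ⟨c, hc, hP⟩ := hP
  have h1 := hP _ hh
  rw [← pairMeasure, integral_eq_zero_of_ae (hae.mono fun z hz => by
    simp [hz, Real.zero_rpow hp0.ne'])] at h1
  have hhΩ : MemLp (f - g) (ENNReal.ofReal p) (ν.restrict Ω) :=
    hh.1.mono_measure (Measure.restrict_mono_set ν (subset_cl m Ω))
  have hnn : 0 ≤ ∫ x in Ω, |(f - g) x| ^ p ∂ν := integral_nonneg fun x => by positivity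
  have h2 : ∫ x in Ω, |(f - g) x| ^ p ∂ν = 0 :=
    le_antisymm (nonpos_of_mul_nonpos_right h1 hc) hnn
  rw [integral_eq_zero_iff_of_nonneg (fun x => by positivity) (integrable_abs_rpow hp hhΩ)] at h2
  have h3 : f =ᵐ[ν.restrict Ω] g := by
    filter_upwards [h2] with x hx
    simpa [Real.rpow_eq_zero (abs_nonneg _) hp0.ne', sub_eq_zero] using hx
  exact (hf.1.ae_eq_indicator hΩ).trans
    ((indicator_ae_eq hΩ h3).trans (hg.1.ae_eq_indicator hΩ).symm)

end Uniqueness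

section UpperBound

lemma abs_grad_indicator_rpow {X : Type*} {p : ℝ} (hp : 1 < p) (E : Set X) (z : X × X) :
    |grad (E.indicator fun _ => 1) z| ^ p = |grad (E.indicator fun _ => 1) z| := by
  have hp0 : p ≠ 0 := by linarith
  by_cases h1 : z.1 ∈ E <;> by_cases h2 : z.2 ∈ E <;> simp [grad, h1, h2, Real.zero_rpow hp0]

variable {X : Type*} [MeasurableSpace X] {m : Kernel X X} {ν : Measure X} {Ω : Set X} {p : ℝ}
  [IsMarkovKernel m] [SigmaFinite ν]

lemma IsTorsional.energy_eq (hp : 1 < p) (hrev : m.IsReversible ν) (hΩ : MeasurableSet Ω)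
    (hfin : ν (cl m Ω) < ⊤) {f : X → ℝ} (hf : IsTorsional m ν Ω p f) :
    ∫ z, |grad f z| ^ p ∂(pairMeasure m ν Ω) = 2 * ∫ x in Ω, f x ∂ν := by
  rw [← hf.weak hp hrev hΩ hfin hf.1]
  simp only [oddPow_mul_self hp]

lemma IsTorsional.integral_pos (hp : 1 < p) (hrev : m.IsReversible ν) (hΩ : MeasurableSet Ω)
    (hpos : 0 < ν Ω) (hfin : ν (cl m Ω) < ⊤) {f : X → ℝ} (hf : IsTorsional m ν Ω p f) :
    0 < ∫ x in Ω, f x ∂ν := by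
  have hp0 : 0 < p := by linarith
  have hfst := map_fst_pairMeasure_le (m := m) (ν := ν) hΩ
  have hsnd := map_snd_pairMeasure_le hrev hΩ hfin
  have he := hf.energy_eq hp hrev hΩ hfin
  have hnn : 0 ≤ ∫ z, |grad f z| ^ p ∂(pairMeasure m ν Ω) :=
    integral_nonneg fun z => by positivity
  refine lt_of_le_of_ne (by linarith) fun h0 => ?_
  rw [← h0, mul_zero, integral_eq_zero_iff_of_nonneg (fun z => by positivity)
    (integrable_abs_rpow hp (memLp_grad hfst hsnd hf.1.1))] at he
  have hw := hf.weak hp hrev hΩ hfin (memLpZero_indicator_one (p := p) hΩ hfin hΩ subset_rfl)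
  rw [integral_eq_zero_of_ae, integral_indicator hΩ] at hw
  · simp only [Measure.restrict_restrict hΩ, inter_self, integral_const, smul_eq_mul,
      mul_one, measureReal_restrict_apply_univ] at hw
    have := ENNReal.toReal_pos hpos.ne' ((measure_mono (subset_cl m Ω)).trans_lt hfin).ne
    rw [measureReal_def] at hw
    linarith
  · filter_upwards [he] with z hz
    have hz' : grad f z = 0 := by
      simpa [Real.rpow_eq_zero (abs_nonneg _) hp0.ne'] using hz
    simp [hz', oddPow]

lemma integral_abs_grad_indicator (hrev : m.IsReversible ν) (hΩ : MeasurableSet Ω)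
    {E : Set X} (hE : MeasurableSet E) (hEΩ : E ⊆ Ω) :
    ∫ z, |grad (E.indicator fun _ => 1) z| ∂(pairMeasure m ν Ω)
      = 2 * (perimeter m ν E).toReal := by
  have hm : Measurable (E.indicator fun _ => (1 : ℝ)) := measurable_const.indicator hE
  have hg : Measurable (grad (E.indicator fun _ => (1 : ℝ))) :=
    (hm.comp measurable_snd).sub (hm.comp measurable_fst)
  rw [perimeter_eq hrev hΩ hEΩ, integral_eq_lintegral_of_nonneg_ae
    (ae_of_all _ fun z => abs_nonneg _) hg.norm.aestronglyMeasurable, ENNReal.toReal_mul]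
  simp

lemma IsTorsional.measure_rpow_le (hp : 1 < p) (hrev : m.IsReversible ν) (hΩ : MeasurableSet Ω)
    (hfin : ν (cl m Ω) < ⊤) {f : X → ℝ} (hf : IsTorsional m ν Ω p f) {E : Set X}
    (hE : MeasurableSet E) (hEΩ : E ⊆ Ω) :
    (ν E).toReal ^ p ≤ (perimeter m ν E).toReal * (∫ x in Ω, f x ∂ν) ^ (p - 1) := by
  have hp0 : 0 < p := by linarith
  have hfst := map_fst_pairMeasure_le (m := m) (ν := ν) hΩ
  have hsnd := map_snd_pairMeasure_le hrev hΩ hfin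
  have hz := memLpZero_indicator_one (m := m) (p := p) hΩ hfin hE hEΩ
  have he := hf.energy_eq hp hrev hΩ hfin
  have hI : 0 ≤ 2 * ∫ x in Ω, f x ∂ν := he ▸ integral_nonneg fun z => by positivity
  have hH := integral_oddPow_mul_le hp (memLp_grad hfst hsnd hf.1.1) (memLp_grad hfst hsnd hz.1)
  simp only [abs_grad_indicator_rpow hp] at hH
  rw [hf.weak hp hrev hΩ hfin hz, integral_abs_grad_indicator hrev hΩ hE hEΩ, he,
    integral_indicator hE, Measure.restrict_restrict hE, inter_eq_self_of_subset_left hEΩ,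
    integral_const, smul_eq_mul, mul_one, measureReal_restrict_apply_univ, measureReal_def] at hH
  set I := ∫ x in Ω, f x ∂ν
  set P := (perimeter m ν E).toReal with hPdef
  have hP0 : 0 ≤ P := ENNReal.toReal_nonneg
  have hI0 : 0 ≤ I := by linarith
  have h1 := Real.rpow_le_rpow (by positivity) hH hp0.le
  rw [Real.mul_rpow (by positivity) (by positivity), Real.mul_rpow (by positivity) (by positivity),
    ← Real.rpow_mul hI, ← Real.rpow_mul (by positivity), div_mul_cancel₀ _ hp0.ne',
    div_mul_cancel₀ _ hp0.ne', Real.rpow_one, Real.mul_rpow (by positivity) hI0] at h1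
  have h2 : (2 : ℝ) ^ p = 2 ^ (p - 1) * 2 := by
    rw [← Real.rpow_add_one (by norm_num)]; congr 1; ring
  rw [h2] at h1
  have h3 : (0 : ℝ) < 2 ^ (p - 1) * 2 := by positivity
  refine le_of_mul_le_mul_left (h1.trans (le_of_eq ?_)) h3
  ring

end UpperBound

section Coarea

variable {X : Type*} [MeasurableSpace X]

/-- The layer-cake formula for `|b - a|`. -/
lemma lintegral_abs_sub_indicator {a b : ℝ} (ha : 0 ≤ a) (hb : 0 ≤ b) :
    ∫⁻ t in Ici (0 : ℝ), ENNReal.ofReal |(Iio b).indicator (fun _ => (1 : ℝ)) t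
      - (Iio a).indicator (fun _ => 1) t| = ENNReal.ofReal |b - a| := by
  wlog hab : a ≤ b generalizing a b
  · rw [abs_sub_comm b a, ← this hb ha (not_le.1 hab).le]
    simp only [abs_sub_comm]
  have h : ∀ t : ℝ, ENNReal.ofReal |(Iio b).indicator (fun _ => (1 : ℝ)) t
      - (Iio a).indicator (fun _ => 1) t| = (Ico a b).indicator 1 t := fun t => by
    by_cases h1 : t < a
    · simp [h1, h1.trans_le hab]
    · by_cases h2 : t < b <;> simp [h1, h2, not_lt.1 h1]
  simp_rw [h]
  rw [lintegral_indicator_one measurableSet_Ico, Measure.restrict_apply measurableSet_Ico,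
    inter_eq_self_of_subset_left (Ico_subset_Ici_self.trans (Ici_subset_Ici.2 ha)),
    Real.volume_Ico, abs_of_nonneg (sub_nonneg.2 hab)]

/-- The coarea formula. -/
lemma lintegral_abs_grad_eq {Q : Measure (X × X)} [SFinite Q] {g : X → ℝ} (hg : Measurable g)
    (hg0 : ∀ x, 0 ≤ g x) :
    ∫⁻ z, ENNReal.ofReal |grad g z| ∂Q = ∫⁻ t in Ici (0 : ℝ),
      ∫⁻ z, ENNReal.ofReal |grad ({x | t < g x}.indicator fun _ => 1) z| ∂Q := by
  have hmeas : ∀ φ : X × X → X, Measurable φ →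
      Measurable fun w : (X × X) × ℝ => {x | w.2 < g x}.indicator (fun _ => (1 : ℝ)) (φ w.1) := by
    intro φ hφ
    have hs : MeasurableSet {w : (X × X) × ℝ | w.2 < g (φ w.1)} :=
      measurableSet_lt measurable_snd (hg.comp (hφ.comp measurable_fst))
    exact (measurable_const.indicator hs : Measurable ({w : (X × X) × ℝ | w.2 < g (φ w.1)}.indicator
      fun _ => (1 : ℝ)))
  rw [lintegral_lintegral_swap]
  · refine lintegral_congr fun z => ?_
    rw [grad, ← lintegral_abs_sub_indicator (hg0 z.1) (hg0 z.2)]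
    rfl
  · have h := ((hmeas _ measurable_snd).sub (hmeas _ measurable_fst)).norm.ennreal_ofReal
    exact (h.comp measurable_swap).aemeasurable

variable {m : Kernel X X} {ν : Measure X} {Ω : Set X} {p : ℝ}

lemma cheeger_nonneg (m : Kernel X X) (ν : Measure X) (Ω : Set X) : 0 ≤ cheeger m ν Ω :=
  Real.sInf_nonneg (by rintro r ⟨E, -, -, -, rfl⟩; positivity)

lemma cheeger_le {E : Set X} (hE : MeasurableSet E) (hEΩ : E ⊆ Ω) (hpos : 0 < ν E) :
    cheeger m ν Ω ≤ (perimeter m ν E).toReal / (ν E).toReal :=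
  csInf_le ⟨0, by rintro r ⟨E, -, -, -, rfl⟩; positivity⟩ ⟨E, hE, hEΩ, hpos, rfl⟩

lemma pCheeger_le {E : Set X} (hE : MeasurableSet E) (hEΩ : E ⊆ Ω) (hpos : 0 < ν E) :
    pCheeger m ν Ω p ≤ (perimeter m ν E).toReal / (ν E).toReal ^ p :=
  csInf_le ⟨0, by rintro r ⟨E, -, -, -, rfl⟩; positivity⟩ ⟨E, hE, hEΩ, hpos, rfl⟩

lemma ofReal_cheeger_mul_le (hfin : ν (cl m Ω) < ⊤) {E : Set X} (hE : MeasurableSet E) (hEΩ : E ⊆ Ω) :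
    ENNReal.ofReal (cheeger m ν Ω) * ν E ≤ perimeter m ν E := by
  rcases eq_or_ne (ν E) 0 with h0 | h0
  · simp [h0]
  have hEtop : ν E ≠ ⊤ := ((measure_mono (hEΩ.trans (subset_cl m Ω))).trans_lt hfin).ne
  have h := cheeger_le (m := m) hE hEΩ (pos_iff_ne_zero.2 h0)
  rw [le_div_iff₀ (ENNReal.toReal_pos h0 hEtop)] at h
  rw [← ENNReal.ofReal_toReal hEtop, ← ENNReal.ofReal_mul (cheeger_nonneg m ν Ω)]
  exact ENNReal.ofReal_le_of_le_toReal h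

variable [IsMarkovKernel m] [SigmaFinite ν]

/-- The Cheeger inequality for nonnegative functions vanishing outside `Ω`. -/
lemma ofReal_cheeger_mul_lintegral_le (hrev : m.IsReversible ν) (hΩ : MeasurableSet Ω)
    (hfin : ν (cl m Ω) < ⊤) {g : X → ℝ} (hg : Measurable g) (hg0 : ∀ x, 0 ≤ g x)
    (hgΩ : ∀ x, x ∉ Ω → g x = 0) :
    ENNReal.ofReal (cheeger m ν Ω) * ∫⁻ x in Ω, ENNReal.ofReal (g x) ∂ν
      ≤ (1 / 2) * ∫⁻ z, ENNReal.ofReal |grad g z| ∂(pairMeasure m ν Ω) := by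
  have := isFiniteMeasure_pairMeasure (m := m) hΩ hfin
  rw [lintegral_eq_lintegral_meas_lt _ (ae_of_all _ hg0) hg.aemeasurable,
    lintegral_abs_grad_eq hg hg0, restrict_Ioi_eq_restrict_Ici,
    ← lintegral_const_mul' _ _ ENNReal.ofReal_ne_top, ← lintegral_const_mul' _ _ (by simp)]
  refine setLIntegral_mono' measurableSet_Ici fun t ht => ?_
  have hE : MeasurableSet {x | t < g x} := measurableSet_lt measurable_const hg
  have hEΩ : {x | t < g x} ⊆ Ω := fun x hx => by
    by_contra h
    have : t < g x := hx
    rw [hgΩ x h] at this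
    exact this.not_ge ht
  rw [← perimeter_eq hrev hΩ hEΩ, Measure.restrict_apply hE, inter_eq_self_of_subset_left hEΩ]
  exact ofReal_cheeger_mul_le hfin hE hEΩ

lemma cheeger_mul_integral_abs_le (hp : 1 < p) (hrev : m.IsReversible ν) (hΩ : MeasurableSet Ω)
    (hfin : ν (cl m Ω) < ⊤) {f : X → ℝ} (hf : MemLpZero m ν Ω p f) :
    cheeger m ν Ω * ∫ x in Ω, |f x| ∂ν
      ≤ (1 / 2) * ∫ z, |grad f z| ∂(pairMeasure m ν Ω) := by
  have := isFiniteMeasure_pairMeasure (m := m) hΩ hfin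
  have hfst := map_fst_pairMeasure_le (m := m) (ν := ν) hΩ
  have hsnd := map_snd_pairMeasure_le hrev hΩ hfin
  have hle : ν.restrict Ω ≤ ν.restrict (cl m Ω) := Measure.restrict_mono_set ν (subset_cl m Ω)
  set f₀ := hf.1.1.mk f with hf₀
  have hfm : Measurable f₀ := hf.1.1.stronglyMeasurable_mk.measurable
  have hff : f =ᵐ[ν.restrict (cl m Ω)] f₀ := hf.1.1.ae_eq_mk
  set g : X → ℝ := Ω.indicator fun x => |f₀ x| with hg
  have hgm : Measurable g := hfm.norm.indicator hΩ
  have hfg : (fun x => |f x|) =ᵐ[ν.restrict (cl m Ω)] g := by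
    filter_upwards [hf.ae_eq_indicator hΩ, hff] with x h1 h2
    by_cases hx : x ∈ Ω
    · rw [hg, indicator_of_mem hx, h2]
    · rw [hg, indicator_of_notMem hx, h1, indicator_of_notMem hx, abs_zero]
  have h := ofReal_cheeger_mul_lintegral_le hrev hΩ hfin hgm
    (fun x => indicator_nonneg (fun _ _ => abs_nonneg _) x) fun x hx => indicator_of_notMem hx _
  have hgrad : MemLp (grad f) (ENNReal.ofReal p) (pairMeasure m ν Ω) := memLp_grad hfst hsnd hf.1
  have hint : Integrable (fun z => |grad f z|) (pairMeasure m ν Ω) :=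
    (hgrad.integrable (by simpa using hp.le)).norm
  have h1 : ∫⁻ z, ENNReal.ofReal |grad g z| ∂(pairMeasure m ν Ω)
      ≤ ∫⁻ z, ENNReal.ofReal |grad f z| ∂(pairMeasure m ν Ω) := by
    refine lintegral_mono_ae ?_
    filter_upwards [grad_ae_eq hfst hsnd hfg] with z hz
    rw [← hz]
    exact ENNReal.ofReal_le_ofReal (abs_abs_sub_abs_le _ _)
  have h2 : ∫⁻ x in Ω, ENNReal.ofReal |f x| ∂ν = ∫⁻ x in Ω, ENNReal.ofReal (g x) ∂ν :=
    lintegral_congr_ae ((hfg.filter_mono (ae_mono hle)).mono fun x hx => by simp only [← hx])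
  rw [← h2] at h
  have h3 := h.trans (mul_le_mul_right h1 _)
  rw [integral_eq_lintegral_of_nonneg_ae (ae_of_all _ fun _ => abs_nonneg _)
    (hf.1.1.mono_measure hle).norm, integral_eq_lintegral_of_nonneg_ae
    (ae_of_all _ fun _ => abs_nonneg _) hint.1]
  have h4 := ENNReal.toReal_mono (ENNReal.mul_ne_top (by simp) ?_) h3
  · rw [ENNReal.toReal_mul, ENNReal.toReal_mul, ENNReal.toReal_ofReal (cheeger_nonneg m ν Ω)] at h4
    simpa using h4
  · rw [← ofReal_integral_eq_lintegral_ofReal hint (ae_of_all _ fun _ => abs_nonneg _)]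
    exact ENNReal.ofReal_ne_top

lemma IsTorsional.cheeger_rpow_mul_le (hp : 1 < p) (hrev : m.IsReversible ν)
    (hΩ : MeasurableSet Ω) (hpos : 0 < ν Ω) (hfin : ν (cl m Ω) < ⊤) {f : X → ℝ}
    (hf : IsTorsional m ν Ω p f) :
    2 ^ (p - 1) * cheeger m ν Ω ^ p * (∫ x in Ω, f x ∂ν) ^ (p - 1)
      ≤ (ν (cl m Ω)).toReal ^ (p - 1) := by
  have hp0 : 0 < p := by linarith
  have := isFiniteMeasure_pairMeasure (m := m) hΩ hfin
  have hfst := map_fst_pairMeasure_le (m := m) (ν := ν) hΩ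
  have hsnd := map_snd_pairMeasure_le hrev hΩ hfin
  have hgrad := memLp_grad hfst hsnd hf.1.1
  have he := hf.energy_eq hp hrev hΩ hfin
  have hI0 := hf.integral_pos hp hrev hΩ hpos hfin
  have h1 := cheeger_mul_integral_abs_le hp hrev hΩ hfin hf.1
  have h2 : ∫ x in Ω, f x ∂ν ≤ ∫ x in Ω, |f x| ∂ν :=
    (le_abs_self _).trans abs_integral_le_integral_abs
  have h3 := integral_oddPow_mul_le hp (memLp_const (μ := pairMeasure m ν Ω) (1 : ℝ)) hgrad.norm
  simp only [oddPow, Real.norm_eq_abs, abs_one, Real.one_rpow, one_mul, abs_abs, he,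
    integral_const, smul_eq_mul, mul_one] at h3
  have hV : (pairMeasure m ν Ω).real univ ≤ (ν (cl m Ω)).toReal :=
    ENNReal.toReal_mono hfin.ne (pairMeasure_univ_le hΩ)
  have hc0 := cheeger_nonneg m ν Ω
  set I := ∫ x in Ω, f x ∂ν
  set V := (ν (cl m Ω)).toReal with hVdef
  set c := cheeger m ν Ω
  have hV0 : 0 ≤ V := ENNReal.toReal_nonneg
  have hR0 : 0 ≤ (pairMeasure m ν Ω).real univ := measureReal_nonneg
  have h4 : c * (2 * I) ≤ V ^ ((p - 1) / p) * (2 * I) ^ (1 / p) := by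
    have h5 : (pairMeasure m ν Ω).real univ ^ ((p - 1) / p) * (2 * I) ^ (1 / p)
        ≤ V ^ ((p - 1) / p) * (2 * I) ^ (1 / p) := by
      have : 0 ≤ (p - 1) / p := div_nonneg (by linarith) hp0.le
      gcongr
    have h6 := mul_le_mul_of_nonneg_left h2 hc0
    linarith
  have hG : 0 < 2 * I := by linarith
  have h5 := Real.rpow_le_rpow (by positivity) h4 hp0.le
  have hsplit : (2 * I) ^ p = (2 * I) ^ (p - 1) * (2 * I) := by
    rw [← Real.rpow_add_one hG.ne']; congr 1; ring
  rw [Real.mul_rpow hc0 hG.le,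
    Real.mul_rpow (Real.rpow_nonneg hV0 _) (Real.rpow_nonneg hG.le _),
    ← Real.rpow_mul hV0, ← Real.rpow_mul hG.le, div_mul_cancel₀ _ hp0.ne',
    div_mul_cancel₀ _ hp0.ne', Real.rpow_one, hsplit, ← mul_assoc] at h5
  have h6 := le_of_mul_le_mul_right h5 hG
  rw [Real.mul_rpow (by norm_num) hI0.le] at h6
  linarith

end Coarea

section Rigidity

variable {X : Type*} [MeasurableSpace X] {m : Kernel X X} {ν : Measure X} {Ω : Set X} {p : ℝ}

lemma exists_isTorsional_torsionalRigidity_eq (h : ∃ f : X → ℝ, IsTorsional m ν Ω p f) :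
    ∃ f : X → ℝ, IsTorsional m ν Ω p f ∧
      torsionalRigidity m ν Ω p = (∫ x in Ω, f x ∂ν) ^ (p - 1) :=
  ⟨h.choose, h.choose_spec, by rw [torsionalRigidity, dif_pos h]⟩

lemma tendsto_cheeger_lower (hpos : 0 < ν Ω) (hfin : ν (cl m Ω) < ⊤) :
    Tendsto (fun p : ℝ => 2 ^ (p - 1) * cheeger m ν Ω ^ p / (ν (cl m Ω)).toReal ^ (p - 1))
      (𝓝[>] 1) (𝓝 (cheeger m ν Ω)) := by
  have hV : 0 < (ν (cl m Ω)).toReal :=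
    ENNReal.toReal_pos (hpos.trans_le (measure_mono (subset_cl m Ω))).ne' hfin.ne
  have hsub : Tendsto (fun p : ℝ => p - 1) (𝓝 1) (𝓝 0) := by
    simpa using (tendsto_id (x := 𝓝 (1 : ℝ))).sub_const 1
  have hpow : ∀ a : ℝ, 0 < a → Tendsto (fun p : ℝ => a ^ (p - 1)) (𝓝 1) (𝓝 1) := fun a ha => by
    simpa [Function.comp_def] using
      (Real.continuousAt_const_rpow (b := 0) ha.ne').tendsto.comp hsub
  have hc : Tendsto (fun p : ℝ => cheeger m ν Ω ^ p) (𝓝 1) (𝓝 (cheeger m ν Ω)) := by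
    simpa using (Real.continuousAt_const_rpow' (a := cheeger m ν Ω) one_ne_zero).tendsto
  have h := ((hpow 2 two_pos).mul hc).div (hpow _ hV) one_ne_zero
  simp only [one_mul, div_one] at h
  exact h.mono_left nhdsWithin_le_nhds

lemma eventually_pCheeger_lt (hpos : 0 < ν Ω) (hΩ : MeasurableSet Ω) (hfin : ν (cl m Ω) < ⊤)
    {c : ℝ} (hc : cheeger m ν Ω < c) : ∀ᶠ p : ℝ in 𝓝[>] 1, pCheeger m ν Ω p < c := by
  obtain ⟨r, ⟨E, hE, hEΩ, hEpos, rfl⟩, hr⟩ := exists_lt_of_csInf_lt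
    (⟨_, Ω, hΩ, subset_rfl, hpos, rfl⟩ : {r : ℝ | ∃ E : Set X, MeasurableSet E ∧ E ⊆ Ω ∧ 0 < ν E ∧
      r = (perimeter m ν E).toReal / (ν E).toReal}.Nonempty) hc
  have hE0 : 0 < (ν E).toReal := ENNReal.toReal_pos hEpos.ne'
    ((measure_mono (hEΩ.trans (subset_cl m Ω))).trans_lt hfin).ne
  have h : Tendsto (fun p : ℝ => (perimeter m ν E).toReal / (ν E).toReal ^ p) (𝓝 1)
      (𝓝 ((perimeter m ν E).toReal / (ν E).toReal)) := by
    refine tendsto_const_nhds.div ?_ hE0.ne'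
    simpa using (Real.continuousAt_const_rpow (b := 1) hE0.ne').tendsto
  filter_upwards [(h.mono_left nhdsWithin_le_nhds).eventually_lt_const hr] with p hp
  exact (pCheeger_le hE hEΩ hEpos).trans_lt hp

/-- Squeezing between the lower bound of the torsional rigidity and the `p`-Cheeger constant. -/
lemma tendsto_cheeger_of_le_of_le (hpos : 0 < ν Ω) (hΩ : MeasurableSet Ω)
    (hfin : ν (cl m Ω) < ⊤) {F : ℝ → ℝ}
    (hlow : ∀ᶠ p : ℝ in 𝓝[>] 1,
      2 ^ (p - 1) * cheeger m ν Ω ^ p / (ν (cl m Ω)).toReal ^ (p - 1) ≤ F p)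
    (hup : ∀ᶠ p : ℝ in 𝓝[>] 1, F p ≤ pCheeger m ν Ω p) :
    Tendsto F (𝓝[>] 1) (𝓝 (cheeger m ν Ω)) := by
  refine tendsto_order.2 ⟨fun a ha => ?_, fun a ha => ?_⟩
  · filter_upwards [hlow, (tendsto_cheeger_lower hpos hfin).eventually_const_lt ha] with p h1 h2
    exact h2.trans_le h1
  · filter_upwards [hup, eventually_pCheeger_lt hpos hΩ hfin ha] with p h1 h2
    exact h1.trans_lt h2

variable [IsMarkovKernel m] [SigmaFinite ν]

/-- Positivity of the torsional rigidity and its comparison with the Cheeger constants. -/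
lemma torsionalRigidity_bounds (hp : 1 < p) (hrev : m.IsReversible ν)
    (hΩ : MeasurableSet Ω) (hpos : 0 < ν Ω) (hfin : ν (cl m Ω) < ⊤) (hP : Poincare m ν Ω p) :
    0 < torsionalRigidity m ν Ω p ∧
      2 ^ (p - 1) * cheeger m ν Ω ^ p / (ν (cl m Ω)).toReal ^ (p - 1)
        ≤ 1 / torsionalRigidity m ν Ω p ∧
      1 / torsionalRigidity m ν Ω p ≤ pCheeger m ν Ω p := by
  obtain ⟨f, hf, hT⟩ := exists_isTorsional_torsionalRigidity_eq
    (exists_isTorsional hp hrev hΩ hfin hP)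
  have hT0 : 0 < torsionalRigidity m ν Ω p :=
    hT ▸ Real.rpow_pos_of_pos (hf.integral_pos hp hrev hΩ hpos hfin) _
  have hV : 0 < (ν (cl m Ω)).toReal :=
    ENNReal.toReal_pos (hpos.trans_le (measure_mono (subset_cl m Ω))).ne' hfin.ne
  refine ⟨hT0, ?_, ?_⟩
  · rw [div_le_div_iff₀ (by positivity) hT0, one_mul, hT]
    exact hf.cheeger_rpow_mul_le hp hrev hΩ hpos hfin
  · refine le_csInf ⟨_, Ω, hΩ, subset_rfl, hpos, rfl⟩ ?_
    rintro r ⟨E, hE, hEΩ, hEpos, rfl⟩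
    have hE0 : 0 < (ν E).toReal := ENNReal.toReal_pos hEpos.ne'
      ((measure_mono (hEΩ.trans (subset_cl m Ω))).trans_lt hfin).ne
    rw [div_le_div_iff₀ hT0 (by positivity), one_mul, hT]
    exact hf.measure_rpow_le hp hrev hΩ hfin hE hEΩ

end Rigidity

end RandomWalk

theorem mainTheorem8 {X : Type*} [MeasurableSpace X] [MeasurableSpace.CountablyGenerated X]
    (m : Kernel X X) [IsMarkovKernel m] (ν : Measure X) [SigmaFinite ν]
    (hrev : m.IsReversible ν)
    (Ω : Set X) (hΩ : MeasurableSet Ω) (hconn : RandomWalk.IsConnectedSet m ν Ω)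
    (hpos : 0 < ν Ω) (hlt : ν Ω < ν (RandomWalk.cl m Ω)) (hfin : ν (RandomWalk.cl m Ω) < ⊤) :
    (∀ p : ℝ, 1 < p → RandomWalk.Poincare m ν Ω p →
      -- the `p`-torsional function exists and is unique, and the torsional rigidity is positive
      (∃ f : X → ℝ, RandomWalk.IsTorsional m ν Ω p f) ∧
      (∀ f g : X → ℝ, RandomWalk.IsTorsional m ν Ω p f → RandomWalk.IsTorsional m ν Ω p g →
        f =ᵐ[ν.restrict (RandomWalk.cl m Ω)] g) ∧
      0 < RandomWalk.torsionalRigidity m ν Ω p ∧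
      -- the two inequalities
      2 ^ (p - 1) * RandomWalk.cheeger m ν Ω ^ p / (ν (RandomWalk.cl m Ω)).toReal ^ (p - 1)
        ≤ 1 / RandomWalk.torsionalRigidity m ν Ω p ∧
      1 / RandomWalk.torsionalRigidity m ν Ω p ≤ RandomWalk.pCheeger m ν Ω p) ∧
    ((∀ᶠ p : ℝ in 𝓝[>] 1, RandomWalk.Poincare m ν Ω p) →
      Tendsto (fun p : ℝ => 1 / RandomWalk.torsionalRigidity m ν Ω p) (𝓝[>] 1)
        (𝓝 (RandomWalk.cheeger m ν Ω)) ∧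
      Tendsto (fun p : ℝ => RandomWalk.pCheeger m ν Ω p) (𝓝[>] 1)
        (𝓝 (RandomWalk.cheeger m ν Ω))) := by
  refine ⟨fun p hp hP => ⟨RandomWalk.exists_isTorsional hp hrev hΩ hfin hP,
    fun f g hf hg => hf.ae_eq hp hrev hΩ hfin hP hg,
    RandomWalk.torsionalRigidity_bounds hp hrev hΩ hpos hfin hP⟩, fun hP => ?_⟩
  have hb := (hP.and self_mem_nhdsWithin).mono fun p h =>
    (RandomWalk.torsionalRigidity_bounds h.2 hrev hΩ hpos hfin h.1).2
  exact ⟨RandomWalk.tendsto_cheeger_of_le_of_le hpos hΩ hfin (hb.mono fun p h => h.1)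
      (hb.mono fun p h => h.2),
    RandomWalk.tendsto_cheeger_of_le_of_le hpos hΩ hfin (hb.mono fun p h => h.1.trans h.2)
      (Eventually.of_forall fun p => le_rfl)⟩
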